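/- All alphabets are finite, and languages and functions are over such alphabets. Let $\mathrm{REG}$ and $\mathrm{CFL}$ be the families of regular and of context-free languages, and let $\mathrm{CFL}(k)=\{\bigcap_{i=1}^k A_i \mid A_1,\dots,A_k\in\mathrm{CFL}\}$, where $A_1,\dots,A_k$ are over a common alphabet. For a language family $\mathcal C$, $\mathrm{co}\,\mathcal C$ is the family of complements $\Sigma^*\setminus L$ of the languages $L\subseteq\Sigma^*$ in $\mathcal C$. An npda is a one-way one-head nondeterministic pushdown automaton, with $\lambda$-moves, whose input is placed between two endmarkers. It has disjoint sets of accepting and rejecting states, which are its halting states, and it is required that all of its computation paths reach a halting state within $O(n)$ steps on inputs of length $n$. It may have write-only tapes, on each of which every move writes at most one symbol. A multi-valued partial function $f:\Sigma^*\to\mathcal P(\Gamma^*)$ is in $\mathrm{CFLMV}$ if some npda with a write-only output tape produces, for every $x\in\Sigma^*$, exactly the strings in $f(x)$ as its outputs along the accepting computation paths on $x$. The class $\mathrm{CFLSV}_t$ consists of those $f\in\mathrm{CFLMV}$ with $|f(x)|=1$ for all $x$. For strings $x,y$, let $\left[{x\atop y}\right]$ be the string of pairs of symbols with upper track $x$ and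 lower track $y$, the shorter of the two strings being padded at its end with a new symbol $\#$. For a language family $\mathcal C$ and a function class $\mathcal F$, let $\mathcal C/\!/\mathcal F$ be the family of languages $L=\{x \mid \exists y\in h(x)\ \left[{x\atop y}\right]\in B\}$ with $B\in\mathcal C$ and $h\in\mathcal F$. For a language $A$, $\mathrm{CFLSV}_m^A$ is the class of functions $f$ with $|f(x)|\le 1$ for all $x$ for which there is an npda $M$ with two write-only tapes, an output tape and a query tape, such that for every $x$, $f(x)$ is the set of the strings $z_p$ for which $p$ is an accepting computation path of $M$ on $x$ with output string $z_p$ whose query string $y_p$ belongs to $A$. Let $\mathrm{CFL}_m^A$ be the family of languages $L$ such that the function $\eta_L$, with $\eta_L(x)=\{1\}$ if $x\in L$ and $\eta_L(x)=\emptyset$ otherwise, is in $\mathrm{CFLSV}_m^A$, and let $\mathrm{CFL}_m^{\mathcal C}=\bigcup_{A\in\mathcal C}\mathrm{CFL}_m^A$. **Proposition.** 1. $\mathrm{REG}/\!/\mathrm{CFLSV}_t\subseteq \mathrm{CFL}_m^{\mathrm{CFL}(2)}\cap \mathrm{co}\,\mathrm{CFL}_m^{\mathrm{CFL}(2)}$.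 2. $\mathrm{CFL}/\!/\mathrm{CFLSV}_t\subseteq \mathrm{CFL}_m^{\mathrm{CFL}(3)}$. -/

import Mathlib

namespace CFLFun

/-! ### Languages, functions, and families of them

Alphabets are finite types.  A multi-valued partial function from `α*` to `γ*` is a map
`List α → Set (List γ)`; it is undefined at `x` when its value there is empty. -/

/-- A family of languages, sorted by the alphabet. -/
abbrev LanguageFamily : Type 1 := ∀ α : Type, Set (Language α)

/-- Multi-valued partial functions from `α*` to `γ*`. -/
abbrev MVFun (α γ : Type) : Type := List α → Set (List γ)

/-- A family of multi-valued partial functions, sorted by the input and output alphabets. -/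
abbrev FunctionFamily : Type 1 := ∀ α γ : Type, Set (MVFun α γ)

/-- The family of regular languages. -/
def REG : LanguageFamily := fun _ => {L | L.IsRegular}

/-- The family of context-free languages. -/
def CFL : LanguageFamily := fun _ => {L | L.IsContextFree}

/-- The `k`-conjunctive closure of `CFL`: intersections of `k` context-free languages over
a common alphabet. -/
def CFLConj (k : ℕ) : LanguageFamily := fun α =>
  {L | ∃ A : Fin k → Language α, (∀ i, A i ∈ CFL α) ∧ L = {w | ∀ i, w ∈ A i}}

/-- Complements of the members of a language family. -/
def co (C : LanguageFamily) : LanguageFamily := fun α => {L | Lᶜ ∈ C α}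

/-! ### Nondeterministic pushdown automata with write-only tapes -/

/-- Contents of an input tape cell: an input symbol or one of the two endmarkers. -/
inductive TapeSymbol (α : Type) : Type
  | left : TapeSymbol α
  | sym : α → TapeSymbol α
  | right : TapeSymbol α

/-- One-way nondeterministic pushdown automata over the input alphabet `α`.  Every move emits
an element of `ω`, recording what is written on the write-only tape(s): `ω = Option γ` for one
output tape over `γ`, and `ω = Option γ × Option δ` for an output tape over `γ` and a query tape
over `δ` (`none`: nothing is written on that tape).  In `trans q s z`, the argument `s` is the
tape symbol that is read, or `none` for a `λ`-move, and `z` is the topmost stack symbol, which is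
replaced by a string of stack symbols (topmost symbol first). -/
structure NPDA (α ω : Type) : Type 1 where
  State : Type
  Stack : Type
  finite_state : Finite State
  finite_stack : Finite Stack
  start : State
  bottom : Stack
  acc : Set State
  rej : Set State
  disjoint_acc_rej : Disjoint acc rej
  trans : State → Option (TapeSymbol α) → Stack → Set (State × List Stack × ω)
  finite_trans : ∀ q s z, (trans q s z).Finite

namespace NPDA

variable {α ω : Type}

/-- A configuration: inner state, unread part of the input tape, stack (topmost first). -/
structure Config (M : NPDA α ω) : Type where
  state : M.State
  input : List (TapeSymbol α)
  stack : List M.Stack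

/-- The halting states. -/
def halt (M : NPDA α ω) : Set M.State := M.acc ∪ M.rej

/-- The initial configuration: the input tape holds `x` between the endmarkers and the stack
holds only the bottom marker. -/
def init (M : NPDA α ω) (x : List α) : M.Config :=
  ⟨M.start, TapeSymbol.left :: (x.map TapeSymbol.sym ++ [TapeSymbol.right]), [M.bottom]⟩

/-- `M.Step c w c'`: one move from `c` to `c'` with emission `w`.  There is no move from a
halting state. -/
inductive Step (M : NPDA α ω) : M.Config → ω → M.Config → Prop
  | read {q q' : M.State} {s : TapeSymbol α} {u : List (TapeSymbol α)} {z : M.Stack}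
      {v β : List M.Stack} {w : ω} :
      q ∉ M.halt → (q', β, w) ∈ M.trans q (some s) z →
      Step M ⟨q, s :: u, z :: v⟩ w ⟨q', u, β ++ v⟩
  | silent {q q' : M.State} {u : List (TapeSymbol α)} {z : M.Stack}
      {v β : List M.Stack} {w : ω} :
      q ∉ M.halt → (q', β, w) ∈ M.trans q none z →
      Step M ⟨q, u, z :: v⟩ w ⟨q', u, β ++ v⟩

/-- `M.Run c l c'`: a sequence of `l.length` moves from `c` to `c'`; `l` lists the emissions. -/
inductive Run (M : NPDA α ω) : M.Config → List ω → M.Config → Prop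
  | nil (c : M.Config) : Run M c [] c
  | cons {c c' c'' : M.Config} {w : ω} {l : List ω} :
      M.Step c w c' → Run M c' l c'' → Run M c (w :: l) c''

/-- The termination condition: on inputs of length `n`, all computation paths reach a halting
state within `O(n)` steps.  That is, all partial computations have at most `a * n + b` steps, and
a computation gets stuck only in halting states. -/
def Terminates (M : NPDA α ω) : Prop :=
  ∃ a b : ℕ, ∀ (x : List α) (l : List ω) (c : M.Config), M.Run (M.init x) l c →
    l.length ≤ a * x.length + b ∧ (c.state ∉ M.halt → ∃ w c', M.Step c w c')

/-- `l` is the list of emissions along some accepting computation path on `x`. -/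
def Accepts (M : NPDA α ω) (x : List α) (l : List ω) : Prop :=
  ∃ c : M.Config, M.Run (M.init x) l c ∧ c.state ∈ M.acc

/-- The valid outcomes on `x` of an npda with an output tape. -/
def outcomes {γ : Type} (M : NPDA α (Option γ)) (x : List α) : Set (List γ) :=
  {y | ∃ l, M.Accepts x l ∧ y = l.reduceOption}

/-- The outcomes on `x` of an oracle npda (first tape: output, second tape: query), along the
accepting computation paths whose query string belongs to the oracle `A`. -/
def oracleOutcomes {γ δ : Type} (M : NPDA α (Option γ × Option δ)) (A : Language δ)
    (x : List α) : Set (List γ) :=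
  {z | ∃ l, M.Accepts x l ∧ (l.map Prod.snd).reduceOption ∈ A ∧
    z = (l.map Prod.fst).reduceOption}

end NPDA

/-! ### Classes of CFL functions -/

/-- Functions computed by npda's with an output tape. -/
def CFLMV : FunctionFamily := fun α γ =>
  {f | ∃ M : NPDA α (Option γ), M.Terminates ∧ ∀ x, f x = M.outcomes x}

/-- The single-valued partial functions in `CFLMV`. -/
def CFLSV : FunctionFamily := fun α γ => {f | f ∈ CFLMV α γ ∧ ∀ x, (f x).Subsingleton}

/-- The total functions in `CFLSV`. -/
def CFLSVt : FunctionFamily := fun α γ => {f | f ∈ CFLSV α γ ∧ ∀ x, (f x).Nonempty}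

/-! ### Many-one relativization -/

/-- The functions many-one relative to the oracle `A`. -/
def CFLMVm {δ : Type} (A : Language δ) : FunctionFamily := fun α γ =>
  {f | ∃ M : NPDA α (Option γ × Option δ), M.Terminates ∧ ∀ x, f x = M.oracleOutcomes A x}

/-- The single-valued functions in `CFLMVm A`. -/
def CFLSVm {δ : Type} (A : Language δ) : FunctionFamily := fun α γ =>
  {f | f ∈ CFLMVm A α γ ∧ ∀ x, (f x).Subsingleton}

/-- The quasi-characteristic function of `L`: it has the value `1` on `L` and is undefined
elsewhere. -/
def quasiChar {α : Type} (L : Language α) : MVFun α (Fin 2) := fun x => {y | x ∈ L ∧ y = [1]}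

/-- The languages many-one relative to the oracle `A`. -/
def CFLmOracle {δ : Type} (A : Language δ) : LanguageFamily := fun α =>
  {L | quasiChar L ∈ CFLSVm A α (Fin 2)}

/-- The languages many-one relative to some oracle, over a finite alphabet, in the family `C`. -/
def CFLm (C : LanguageFamily) : LanguageFamily := fun α =>
  {L | ∃ δ : Type, Finite δ ∧ ∃ A ∈ C δ, L ∈ CFLmOracle A α}

/-! ### The advice operator -/

/-- The two-track string with upper track `x` and lower track `y`; the shorter of the two strings
is padded at its end by the new symbol `none`. -/
def track {α γ : Type} (x : List α) (y : List γ) : List (Option α × Option γ) :=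
  List.zipWithAll Prod.mk x y

/-- The class `C // F` of languages recognized with advice functions in `F`. -/
def advice (C : LanguageFamily) (F : FunctionFamily) : LanguageFamily := fun α =>
  {L | ∃ γ : Type, Finite γ ∧ ∃ B ∈ C (Option α × Option γ), ∃ h ∈ F α γ,
    L = {x | ∃ y ∈ h x, track x y ∈ B}}

end CFLFun

namespace CFLFun

/-! Both inclusions follow from a stronger one, `advice_subset_CFLm`: context-free advice languages
with arbitrary `CFLMV` advice already lie in the class relative to `CFL(2)`. Since CFL(2) ⊆ CFL(3),
this gives the second claim. Regular languages are context-free, which gives half of the first. For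
the other half, when `h` is total and single-valued, the complement of the language given by `B` and
`h` is given by `Bᶜ` and `h`, and `REG` is closed under complement.

For the stronger inclusion, let `M` compute the advice. The oracle machine copies its tape to the
query tape and interleaves guessed letters: a two-track string `u`, a reversed computation history
of `M`, and the history `w` itself. All guesses are pushed on the stack and popped at the end, so
the query continues with the guess reversed: reversed history, history, reversed `u`. The first
oracle checks `u ∈ B`, that the two guessed histories mirror each other, that `w` is a history, and
that the upper track of `u` is the input in `w`. The second checks that the copied tape is the tape
in `w` and that the lower track of `u` is the output in `w`. Each comparison is between adjacent
blocks, one of them reversed, so a linear grammar performs it (`mirror_isContextFree`), and each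
oracle is a product of context-free languages. Linear running time bounds the guess linearly, so a
bounded number of guesses per tape symbol suffices.

The remaining ingredient is that histories form a context-free language
(`NPDA.traces_isContextFree`), by the triple construction. -/

/-! ### Context-free languages through parse trees -/

/-- `Parse R β s`: the sentential form `β` derives the word `s` by the context-free rules `R`. -/
inductive Parse {T N : Type} (R : N → List (Symbol T N) → Prop) : List (Symbol T N) → List T → Prop
  | nil : Parse R [] []
  | term {a : T} {β : List (Symbol T N)} {s : List T} :
      Parse R β s → Parse R (Symbol.terminal a :: β) (a :: s)
  | nonterm {A : N} {rhs β : List (Symbol T N)} {s t : List T} :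
      R A rhs → Parse R rhs s → Parse R β t → Parse R (Symbol.nonterminal A :: β) (s ++ t)

namespace Parse

variable {T N : Type} {R : N → List (Symbol T N) → Prop}

theorem nil_iff {s : List T} : Parse R [] s ↔ s = [] :=
  ⟨fun h => by cases h; rfl, fun h => h ▸ .nil⟩

theorem term_iff {a : T} {β : List (Symbol T N)} {s : List T} :
    Parse R (Symbol.terminal a :: β) s ↔ ∃ t, s = a :: t ∧ Parse R β t :=
  ⟨fun h => by cases h with | term h => exact ⟨_, rfl, h⟩, by rintro ⟨t, rfl, h⟩; exact .term h⟩

theorem nonterm_iff {A : N} {β : List (Symbol T N)} {s : List T} :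
    Parse R (Symbol.nonterminal A :: β) s ↔
      ∃ rhs u v, R A rhs ∧ Parse R rhs u ∧ Parse R β v ∧ s = u ++ v :=
  ⟨fun h => by cases h with | nonterm h h₁ h₂ => exact ⟨_, _, _, h, h₁, h₂, rfl⟩,
    by rintro ⟨rhs, u, v, h, h₁, h₂, rfl⟩; exact .nonterm h h₁ h₂⟩

theorem singleton_iff {A : N} {s : List T} :
    Parse R [Symbol.nonterminal A] s ↔ ∃ rhs, R A rhs ∧ Parse R rhs s := by
  simp [nonterm_iff, nil_iff]

theorem append_iff {β β' : List (Symbol T N)} {s : List T} :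
    Parse R (β ++ β') s ↔ ∃ u v, Parse R β u ∧ Parse R β' v ∧ s = u ++ v := by
  induction β generalizing s with
  | nil => simp [nil_iff]
  | cons a β ih =>
    cases a with
    | terminal a =>
      simp only [List.cons_append, term_iff, ih]
      constructor
      · rintro ⟨_, rfl, u, v, hu, hv, rfl⟩
        exact ⟨a :: u, v, ⟨u, rfl, hu⟩, hv, rfl⟩
      · rintro ⟨_, v, ⟨u, rfl, hu⟩, hv, rfl⟩
        exact ⟨_, rfl, u, v, hu, hv, rfl⟩
    | nonterminal A =>
      simp only [List.cons_append, nonterm_iff, ih]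
      constructor
      · rintro ⟨rhs, u, _, h, h₁, ⟨u', v', hu, hv, rfl⟩, rfl⟩
        exact ⟨u ++ u', v', ⟨rhs, u, u', h, h₁, hu, rfl⟩, hv, by simp⟩
      · rintro ⟨_, v, ⟨rhs, u, u', h, h₁, hu, rfl⟩, hv, rfl⟩
        exact ⟨rhs, u, u' ++ v, h, h₁, ⟨u', v, hu, hv, rfl⟩, by simp⟩

theorem map_terminal_iff {w s : List T} : Parse R (w.map Symbol.terminal) s ↔ s = w := by
  induction w generalizing s with
  | nil => simp [nil_iff]
  | cons a w ih => simp [term_iff, ih]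

/-- A context-free grammar, seen as a set of rules. -/
def rulesOf (g : ContextFreeGrammar T) : g.NT → List (Symbol T g.NT) → Prop :=
  fun A rhs => ⟨A, rhs⟩ ∈ g.rules

/-- A derivation is undone from its end: a parse of `p ++ r.output ++ q` splits into three pieces,
and the middle one becomes a subtree below the rewritten nonterminal. This replaces rewriting
sequences by trees, on which structural induction works. -/
theorem derives_iff (g : ContextFreeGrammar T) {β : List (Symbol T g.NT)} {s : List T} :
    g.Derives β (s.map Symbol.terminal) ↔ Parse (rulesOf g) β s := by
  constructor
  · intro h
    induction h using Relation.ReflTransGen.head_induction_on with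
    | refl => exact map_terminal_iff.2 rfl
    | head h _ ih =>
      obtain ⟨r, hr, h⟩ := h
      obtain ⟨p, q, rfl, rfl⟩ := h.exists_parts
      rw [List.append_assoc, append_iff] at ih
      obtain ⟨u, v, hu, hv, rfl⟩ := ih
      obtain ⟨u', v', hu', hv', rfl⟩ := append_iff.1 hv
      rw [List.append_assoc, append_iff]
      exact ⟨u, _, hu, .nonterm (rhs := r.output) hr hu' hv', rfl⟩
  · intro h
    induction h with
    | nil => exact ContextFreeGrammar.Derives.refl _
    | term _ ih => exact ih.append_left [_]
    | @nonterm A rhs β s t hr _ _ ih₁ ih₂ =>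
      have h₁ : g.Produces (Symbol.nonterminal A :: β) (rhs ++ β) :=
        ⟨_, hr, ContextFreeRule.Rewrites.head (r := ⟨A, rhs⟩) β⟩
      refine h₁.trans_derives ((ih₁.append_right β).trans ?_)
      rw [List.map_append]
      exact ih₂.append_left _

end Parse

/-- Only the set of rules has to be finite, so `N` may be an infinite type; the grammar for
`NPDA.traces` relies on this. -/
theorem isContextFree_of_rules {T N : Type} {L : Language T} (R : N → List (Symbol T N) → Prop)
    (hR : {p : N × List (Symbol T N) | R p.1 p.2}.Finite) (A : N)
    (hL : ∀ s, s ∈ L ↔ Parse R [Symbol.nonterminal A] s) : L.IsContextFree := by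
  classical
  have hinj : Function.Injective
      fun p : N × List (Symbol T N) => (⟨p.1, p.2⟩ : ContextFreeRule T N) := by
    rintro ⟨a, b⟩ ⟨c, d⟩ h
    simpa using h
  let g : ContextFreeGrammar T := ⟨N, A, hR.toFinset.map ⟨_, hinj⟩⟩
  have hg : Parse.rulesOf g = R := by
    funext B rhs
    simp [Parse.rulesOf, g]
  refine ⟨g, ?_⟩
  ext s
  rw [ContextFreeGrammar.mem_language_iff, Parse.derives_iff, hg, hL]

theorem exists_rules {T : Type} {L : Language T} (hL : L.IsContextFree) :
    ∃ (N : Type) (R : N → List (Symbol T N) → Prop) (A : N),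
      {p : N × List (Symbol T N) | R p.1 p.2}.Finite ∧
      ∀ s, s ∈ L ↔ Parse R [Symbol.nonterminal A] s := by
  obtain ⟨g, rfl⟩ := hL
  refine ⟨g.NT, Parse.rulesOf g, g.initial, ?_, fun s => ?_⟩
  · have := (g.rules.finite_toSet).image
      (fun r : ContextFreeRule T g.NT => (r.input, r.output))
    refine this.subset ?_
    rintro ⟨A, rhs⟩ h
    exact ⟨⟨A, rhs⟩, h, rfl⟩
  · rw [ContextFreeGrammar.mem_language_iff, Parse.derives_iff]

/-! ### Products -/

/-- Renaming the nonterminals of a symbol. -/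
def renameSymbol {T N N' : Type} (f : N → N') : Symbol T N → Symbol T N'
  | .terminal a => .terminal a
  | .nonterminal A => .nonterminal (f A)

/-- The hypothesis describes the rules of `f A` for every preimage `A`, so a parse tree lifts node
by node and `f` need not be injective. -/
theorem Parse.rename_iff {T N N' : Type} {R : N → List (Symbol T N) → Prop}
    {R' : N' → List (Symbol T N') → Prop} (f : N → N')
    (h : ∀ A rhs', R' (f A) rhs' ↔ ∃ rhs, R A rhs ∧ rhs' = rhs.map (renameSymbol f))
    {β : List (Symbol T N)} {s : List T} :
    Parse R' (β.map (renameSymbol f)) s ↔ Parse R β s := by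
  constructor
  · intro hp
    generalize hβ : β.map (renameSymbol f) = β' at hp
    induction hp generalizing β with
    | nil => obtain rfl := List.map_eq_nil_iff.1 hβ; exact .nil
    | term _ ih =>
      obtain ⟨b, β, rfl, hb, rfl⟩ := List.map_eq_cons_iff.1 hβ
      cases b with
      | terminal a => cases hb; exact .term (ih rfl)
      | nonterminal A => cases hb
    | nonterm hr _ _ ih₁ ih₂ =>
      obtain ⟨b, β, rfl, hb, rfl⟩ := List.map_eq_cons_iff.1 hβ
      cases b with
      | terminal a => cases hb
      | nonterminal A =>
        cases hb
        obtain ⟨rhs, hr', rfl⟩ := (h _ _).1 hr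
        exact .nonterm hr' (ih₁ rfl) (ih₂ rfl)
  · intro hp
    induction hp with
    | nil => exact .nil
    | term _ ih => exact .term ih
    | nonterm hr _ _ ih₁ ih₂ => exact .nonterm ((h _ _).2 ⟨_, hr, rfl⟩) ih₁ ih₂

theorem IsContextFree.mul {T : Type} {L₁ L₂ : Language T} (h₁ : L₁.IsContextFree)
    (h₂ : L₂.IsContextFree) : (L₁ * L₂).IsContextFree := by
  obtain ⟨N₁, R₁, A₁, hf₁, hL₁⟩ := exists_rules h₁
  obtain ⟨N₂, R₂, A₂, hf₂, hL₂⟩ := exists_rules h₂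
  let i₁ : N₁ → Option (N₁ ⊕ N₂) := fun A => some (.inl A)
  let i₂ : N₂ → Option (N₁ ⊕ N₂) := fun A => some (.inr A)
  let R : Option (N₁ ⊕ N₂) → List (Symbol T (Option (N₁ ⊕ N₂))) → Prop := fun A rhs =>
    match A with
    | none => rhs = [.nonterminal (i₁ A₁), .nonterminal (i₂ A₂)]
    | some (.inl A) => ∃ r, R₁ A r ∧ rhs = r.map (renameSymbol i₁)
    | some (.inr A) => ∃ r, R₂ A r ∧ rhs = r.map (renameSymbol i₂)
  have hR : {p : Option (N₁ ⊕ N₂) × List (Symbol T (Option (N₁ ⊕ N₂))) | R p.1 p.2}.Finite := by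
    refine (((hf₁.image fun p => (i₁ p.1, p.2.map (renameSymbol i₁))).union
      (hf₂.image fun p => (i₂ p.1, p.2.map (renameSymbol i₂)))).union
      (Set.finite_singleton (none, [.nonterminal (i₁ A₁), .nonterminal (i₂ A₂)]))).subset ?_
    rintro ⟨_ | A | A, rhs⟩ h
    · exact .inr (Prod.ext rfl h)
    · obtain ⟨r, hr, rfl⟩ := h
      exact .inl (.inl ⟨(A, r), hr, rfl⟩)
    · obtain ⟨r, hr, rfl⟩ := h
      exact .inl (.inr ⟨(A, r), hr, rfl⟩)
  have e₁ : ∀ s, Parse R [.nonterminal (i₁ A₁)] s ↔ s ∈ L₁ := fun s =>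
    (Parse.rename_iff (R := R₁) (R' := R) i₁ (fun _ _ => Iff.rfl)
      (β := [.nonterminal A₁])).trans (hL₁ s).symm
  have e₂ : ∀ s, Parse R [.nonterminal (i₂ A₂)] s ↔ s ∈ L₂ := fun s =>
    (Parse.rename_iff (R := R₂) (R' := R) i₂ (fun _ _ => Iff.rfl)
      (β := [.nonterminal A₂])).trans (hL₂ s).symm
  refine isContextFree_of_rules R hR none fun s => ?_
  rw [Language.mem_mul, Parse.singleton_iff]
  constructor
  · rintro ⟨a, ha, b, hb, rfl⟩
    exact ⟨_, rfl, Parse.append_iff (β := [_]).2 ⟨a, b, (e₁ a).2 ha, (e₂ b).2 hb, rfl⟩⟩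
  · rintro ⟨_, rfl, h⟩
    obtain ⟨a, b, ha, hb, rfl⟩ := Parse.append_iff (β := [_]).1 h
    exact ⟨a, (e₁ a).1 ha, b, (e₂ b).1 hb, rfl⟩

/-! ### Inverse images under letter-or-erase homomorphisms -/

/-- Each terminal `a` becomes a nonterminal `c a`, which generates erased letters followed by one
letter with image `a`. Erased letters thus attach to the next surviving letter, and those after the
last one are generated by `E`. -/
theorem IsContextFree.filterMap_preimage {T δ : Type} [Finite T] [Finite δ] {L : Language T}
    (hL : L.IsContextFree) (ok : δ → Prop) (f : δ → Option T) :
    Language.IsContextFree {s : List δ | (∀ d ∈ s, ok d) ∧ s.filterMap f ∈ L} := by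
  obtain ⟨N, R, A, hf, hL⟩ := exists_rules hL
  let N' := N ⊕ Option (Option T)
  let E : N' := .inr (some none)
  let S : N' := .inr none
  let c : T → N' := fun a => .inr (some (some a))
  let tr : Symbol T N → Symbol δ N' := fun b =>
    match b with
    | .terminal a => .nonterminal (c a)
    | .nonterminal B => .nonterminal (.inl B)
  let R' : N' → List (Symbol δ N') → Prop := fun B rhs =>
    match B with
    | .inl B => ∃ r, R B r ∧ rhs = r.map tr
    | .inr none => rhs = [.nonterminal (.inl A), .nonterminal E]
    | .inr (some none) => rhs = [] ∨
        ∃ e, ok e ∧ f e = none ∧ rhs = [.terminal e, .nonterminal E]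
    | .inr (some (some a)) => (∃ d, ok d ∧ f d = some a ∧ rhs = [.terminal d]) ∨
        ∃ e, ok e ∧ f e = none ∧ rhs = [.terminal e, .nonterminal (c a)]
  have hR : {p : N' × List (Symbol δ N') | R' p.1 p.2}.Finite := by
    refine ((((hf.image fun p => ((.inl p.1 : N'), p.2.map tr)).union
      (Set.toFinite {(S, [.nonterminal (.inl A), .nonterminal E]), (E, [])})).union
      (Set.finite_range fun e : δ => (E, [Symbol.terminal e, .nonterminal E]))).union
      ((Set.finite_range fun p : T × δ => (c p.1, [Symbol.terminal p.2])).union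
      (Set.finite_range fun p : T × δ =>
        (c p.1, [Symbol.terminal p.2, .nonterminal (c p.1)])))).subset ?_
    rintro ⟨B | _ | _ | a, rhs⟩ h
    · obtain ⟨r, hr, rfl⟩ := h
      exact .inl (.inl (.inl ⟨(B, r), hr, rfl⟩))
    · exact .inl (.inl (.inr (.inl (Prod.ext rfl h))))
    · obtain h | ⟨e, -, -, h⟩ := h
      · exact .inl (.inl (.inr (.inr (Prod.ext rfl h))))
      · exact .inl (.inr ⟨e, Prod.ext rfl h.symm⟩)
    · obtain ⟨d, -, -, h⟩ | ⟨e, -, -, h⟩ := h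
      · exact .inr (.inl ⟨(a, d), Prod.ext rfl h.symm⟩)
      · exact .inr (.inr ⟨(a, e), Prod.ext rfl h.symm⟩)
  -- A left inverse of `tr` on sentential forms. It turns every new rule into an old rule or a
  -- trivial identity, so soundness is an induction on the parse.
  let out : Symbol δ N' → Option (Symbol T N) := fun b =>
    match b with
    | .terminal d => (f d).map .terminal
    | .nonterminal (.inl B) => some (.nonterminal B)
    | .nonterminal (.inr none) => some (.nonterminal A)
    | .nonterminal (.inr (some none)) => none
    | .nonterminal (.inr (some (some a))) => some (.terminal a)
  have out_tr : ∀ β : List (Symbol T N), (β.map tr).filterMap out = β := by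
    intro β
    have h : out ∘ tr = some := by
      funext b
      cases b <;> rfl
    rw [List.filterMap_map, h, List.filterMap_some]
  have sound : ∀ β' s, Parse R' β' s → (∀ d, Symbol.terminal d ∈ β' → ok d) →
      (∀ d ∈ s, ok d) ∧ Parse R (β'.filterMap out) (s.filterMap f) := by
    intro β' s h
    induction h with
    | nil => exact fun _ => ⟨by simp, .nil⟩
    | @term d β s _ ih =>
      intro hok
      obtain ⟨h₁, h₂⟩ := ih fun d hd => hok d (.tail _ hd)
      refine ⟨by simpa using ⟨hok d (.head _), h₁⟩, ?_⟩
      cases hd : f d with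
      | none => simpa [List.filterMap_cons, out, hd] using h₂
      | some a => simpa [List.filterMap_cons, out, hd] using h₂.term
    | @nonterm B rhs β s t hr _ _ ih₁ ih₂ =>
      intro hok
      obtain ⟨h₁, h₂⟩ := ih₂ fun d hd => hok d (.tail _ hd)
      have key : (∀ d, Symbol.terminal d ∈ rhs → ok d) ∧
          (Parse R (rhs.filterMap out) (s.filterMap f) →
            Parse R ([Symbol.nonterminal B].filterMap out) (s.filterMap f)) := by
        match B, hr with
        | .inl B, ⟨r, hr', e⟩ =>
          subst e
          refine ⟨?_, fun h => ?_⟩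
          · intro d hd
            obtain ⟨b, -, hb⟩ := List.mem_map.1 hd
            cases b <;> cases hb
          · rw [out_tr] at h
            exact Parse.singleton_iff.2 ⟨r, hr', h⟩
        | .inr none, e =>
          have e : rhs = [.nonterminal (.inl A), .nonterminal E] := e
          subst e
          exact ⟨by simp, fun h => h⟩
        | .inr (some none), .inl e =>
          subst e
          exact ⟨by simp, fun h => h⟩
        | .inr (some none), .inr ⟨e, ho, hn, e'⟩ =>
          subst e'
          exact ⟨by simpa using ho, fun h => by simpa [out, hn, E] using h⟩
        | .inr (some (some a)), .inl ⟨e, ho, hn, e'⟩ =>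
          subst e'
          exact ⟨by simpa using ho, fun h => by simpa [out, hn] using h⟩
        | .inr (some (some a)), .inr ⟨e, ho, hn, e'⟩ =>
          subst e'
          exact ⟨by simpa using ho, fun h => by simpa [out, hn, c] using h⟩
      obtain ⟨h₃, h₄⟩ := ih₁ key.1
      refine ⟨fun d hd => (List.mem_append.1 hd).elim (h₃ d) (h₁ d), ?_⟩
      rw [List.filterMap_append]
      exact (Parse.append_iff (β := [Symbol.nonterminal B].filterMap out)).2
        ⟨_, _, key.2 h₄, h₂, rfl⟩ |> fun h => by
          rwa [← List.filterMap_append] at h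
  have erased : ∀ s : List δ, (∀ d ∈ s, ok d) → s.filterMap f = [] →
      Parse R' [.nonterminal E] s := by
    intro s
    induction s with
    | nil => exact fun _ _ => Parse.singleton_iff.2 ⟨[], .inl rfl, .nil⟩
    | cons d s ih =>
      intro h₁ h₂
      simp only [List.mem_cons, forall_eq_or_imp] at h₁
      have hd : f d = none := List.filterMap_eq_nil_iff.1 h₂ d (.head _)
      rw [List.filterMap_cons_none hd] at h₂
      exact Parse.singleton_iff.2 ⟨_, .inr ⟨d, h₁.1, hd, rfl⟩, .term (ih h₁.2 h₂)⟩
  have letter : ∀ (a : T) (s : List δ) (d : δ), (∀ d ∈ s, ok d) → (∀ d ∈ s, f d = none) →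
      ok d → f d = some a → Parse R' [.nonterminal (c a)] (s ++ [d]) := by
    intro a s d h₁ h₂ hd hfd
    induction s with
    | nil => exact Parse.singleton_iff.2 ⟨_, .inl ⟨d, hd, hfd, rfl⟩, .term .nil⟩
    | cons e s ih =>
      simp only [List.mem_cons, forall_eq_or_imp] at h₁ h₂
      exact Parse.singleton_iff.2 ⟨_, .inr ⟨e, h₁.1, h₂.1, rfl⟩, .term (ih h₁.2 h₂.2)⟩
  have complete : ∀ β t, Parse R β t → ∀ s : List δ, (∀ d ∈ s, ok d) → s.filterMap f = t →
      Parse R' (β.map tr ++ [.nonterminal E]) s := by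
    intro β t h
    induction h with
    | nil => exact erased
    | @term a β t _ ih =>
      intro s h₁ h₂
      obtain ⟨l₁, d, l₂, rfl, hl₁, hd, hl₂⟩ := List.filterMap_eq_cons_iff.1 h₂
      have hl := letter a l₁ d (fun e he => h₁ e (by simp [he])) hl₁ (h₁ d (by simp)) hd
      have := ih l₂ (fun e he => h₁ e (by simp [he])) hl₂
      have h₃ := Parse.append_iff.2 ⟨_, _, hl, this, rfl⟩
      simpa [tr] using h₃
    | @nonterm B rhs β t t' hr _ _ ih₁ ih₂ =>
      intro s h₁ h₂
      obtain ⟨s₁, s₂, rfl, e₁, e₂⟩ := List.filterMap_eq_append_iff.1 h₂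
      -- The part `v` generated by the final `E` consists of erased letters; they are handed over to
      -- the front of `s₂`, where the next symbol absorbs them.
      obtain ⟨u, v, hu, hv, rfl⟩ := Parse.append_iff.1
        (ih₁ s₁ (fun d hd => h₁ d (by simp [hd])) e₁)
      have hv' := (sound _ _ hv (by simp)).2
      have hv' : v.filterMap f = [] := Parse.nil_iff.1 hv'
      have := ih₂ (v ++ s₂) (fun d hd => h₁ d (by simp at hd ⊢; tauto)) (by simp [hv', e₂])
      rw [List.append_assoc]
      exact .nonterm ⟨rhs, hr, rfl⟩ hu this
  refine isContextFree_of_rules R' hR S fun s => ?_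
  change (_ ∧ _) ↔ Parse R' [.nonterminal S] s
  rw [hL]
  constructor
  · rintro ⟨h₁, h₂⟩
    exact Parse.singleton_iff.2 ⟨_, rfl, complete _ _ h₂ s h₁ rfl⟩
  · intro h
    exact sound _ _ h (by simp)

/-! ### Linear grammars -/

/-- The language of a linear grammar: by `R q l r q'`, the state `q` yields `q'` with the optional
letter `l` to its left and the optional letter `r` to its right. -/
inductive Linear {δ Q : Type} (R : Q → Option δ → Option δ → Q → Prop) (F : Q → Prop) :
    Q → List δ → Prop
  | done {q : Q} : F q → Linear R F q []
  | step {q q' : Q} {l r : Option δ} {s : List δ} :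
      R q l r q' → Linear R F q' s → Linear R F q (l.toList ++ s ++ r.toList)

theorem Linear.isContextFree {δ Q : Type} [Finite δ] [Finite Q]
    (R : Q → Option δ → Option δ → Q → Prop) (F : Q → Prop) (q₀ : Q) :
    Language.IsContextFree {s : List δ | Linear R F q₀ s} := by
  let rhs : Option δ → Option δ → Q → List (Symbol δ Q) := fun l r q' =>
    l.toList.map .terminal ++ (.nonterminal q' :: r.toList.map .terminal)
  let R' : Q → List (Symbol δ Q) → Prop := fun q β =>
    (F q ∧ β = []) ∨ ∃ l r q', R q l r q' ∧ β = rhs l r q'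
  have hR : {p : Q × List (Symbol δ Q) | R' p.1 p.2}.Finite := by
    refine ((Set.finite_range fun q : Q => (q, ([] : List (Symbol δ Q)))).union
      (Set.finite_range fun p : Q × Option δ × Option δ × Q =>
        (p.1, rhs p.2.1 p.2.2.1 p.2.2.2))).subset ?_
    rintro ⟨q, β⟩ (⟨-, h⟩ | ⟨l, r, q', -, h⟩)
    · exact .inl ⟨q, Prod.ext rfl h.symm⟩
    · exact .inr ⟨(q, l, r, q'), Prod.ext rfl h.symm⟩
  have rhs_iff : ∀ l r q' s, Parse R' (rhs l r q') s ↔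
      ∃ t, Parse R' [.nonterminal q'] t ∧ s = l.toList ++ t ++ r.toList := by
    intro l r q' s
    have e : (Symbol.nonterminal q' :: r.toList.map .terminal : List (Symbol δ Q)) =
      [Symbol.nonterminal q'] ++ r.toList.map .terminal := rfl
    simp only [rhs, e, Parse.append_iff, Parse.map_terminal_iff]
    constructor
    · rintro ⟨_, _, rfl, ⟨t, _, ht, rfl, rfl⟩, rfl⟩
      exact ⟨t, ht, by simp⟩
    · rintro ⟨t, ht, rfl⟩
      exact ⟨_, _, rfl, ⟨t, _, ht, rfl, rfl⟩, by simp⟩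
  refine isContextFree_of_rules R' hR q₀ fun s => ?_
  change Linear R F q₀ s ↔ _
  constructor
  · intro h
    induction h with
    | done h => exact Parse.singleton_iff.2 ⟨_, .inl ⟨h, rfl⟩, .nil⟩
    | step h _ ih =>
      exact Parse.singleton_iff.2 ⟨_, .inr ⟨_, _, _, h, rfl⟩, (rhs_iff _ _ _ _).2 ⟨_, ih, rfl⟩⟩
  -- The induction passes through sentential forms with exactly one nonterminal, hence the arbitrary
  -- flanking words.
  · have key : ∀ β s, Parse R' β s → ∀ p q r,
        β = p.map .terminal ++ (.nonterminal q :: r.map .terminal) →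
        ∃ t, Linear R F q t ∧ s = p ++ t ++ r := by
      intro β s h
      induction h with
      | nil => intro p q r h; simp at h
      | term _ ih =>
        intro p q r h
        cases p with
        | nil => cases h
        | cons a p =>
          cases h
          obtain ⟨t, ht, rfl⟩ := ih p q r rfl
          exact ⟨t, ht, rfl⟩
      | nonterm hr _ h₂ ih _ =>
        intro p q r h
        cases p with
        | cons a p => cases h
        | nil =>
          cases h
          obtain rfl := Parse.map_terminal_iff.1 h₂
          rcases hr with ⟨hF, rfl⟩ | ⟨l, r, q', hr, rfl⟩
          · rename_i h₁
            obtain rfl := Parse.nil_iff.1 h₁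
            exact ⟨[], .done hF, rfl⟩
          · obtain ⟨t, ht, rfl⟩ := ih _ _ _ rfl
            exact ⟨_, .step hr ht, rfl⟩
    intro h
    obtain ⟨t, ht, rfl⟩ := key _ _ h [] q₀ [] rfl
    simpa using ht

/-! ### Traces of pushdown automata are context-free. -/

/-- The interpretation of a sentential form, given an interpretation of the nonterminals. -/
def Interprets {T N : Type} (I : N → List T → Prop) : List (Symbol T N) → List T → Prop
  | [], s => s = []
  | .terminal a :: β, s => ∃ t, s = a :: t ∧ Interprets I β t
  | .nonterminal A :: β, s => ∃ u v, I A u ∧ Interprets I β v ∧ s = u ++ v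

/-- The generated languages are the least family closed under the rules; this yields soundness of
the trace grammar. -/
theorem Parse.interprets {T N : Type} {R : N → List (Symbol T N) → Prop} {I : N → List T → Prop}
    (hI : ∀ A rhs s, R A rhs → Interprets I rhs s → I A s) {β : List (Symbol T N)} {s : List T}
    (h : Parse R β s) : Interprets I β s := by
  induction h with
  | nil => rfl
  | term _ ih => exact ⟨_, rfl, ih⟩
  | nonterm hr _ _ ih₁ ih₂ => exact ⟨_, _, hI _ _ _ hr ih₁, ih₂, rfl⟩

instance {α : Type} [Finite α] : Finite (TapeSymbol α) :=
  Finite.of_surjective (fun o : Option (Option α) => match o with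
    | none => TapeSymbol.left
    | some none => TapeSymbol.right
    | some (some a) => TapeSymbol.sym a) fun s => match s with
    | .left => ⟨none, rfl⟩
    | .right => ⟨some none, rfl⟩
    | .sym a => ⟨some (some a), rfl⟩

/-- The input tape holding `x` between the endmarkers. -/
def tape {α : Type} (x : List α) : List (TapeSymbol α) :=
  TapeSymbol.left :: (x.map TapeSymbol.sym ++ [TapeSymbol.right])

namespace NPDA

variable {α ω : Type}

theorem Run.append {M : NPDA α ω} {c c' c'' : M.Config} {l l' : List ω} (h : M.Run c l c')
    (h' : M.Run c' l' c'') : M.Run c (l ++ l') c'' := by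
  induction h with
  | nil => exact h'
  | cons hs _ ih => exact .cons hs (ih h')

/-- `M.Pops p v q t`: from state `p`, a computation with letters `t` (the tape symbol read, if any,
and the emission of each move) removes `v` from the stack and ends in state `q`.  The accepting
states may discard stack symbols. -/
inductive Pops (M : NPDA α ω) :
    M.State → List M.Stack → M.State → List (Option (TapeSymbol α) × ω) → Prop
  | nil (p : M.State) : Pops M p [] p []
  | step {p p' r q : M.State} {s : Option (TapeSymbol α)} {z : M.Stack} {β v : List M.Stack}
      {w : ω} {t t' : List (Option (TapeSymbol α) × ω)} :
      p ∉ M.halt → (p', β, w) ∈ M.trans p s z → Pops M p' β r t → Pops M r v q t' →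
      Pops M p (z :: v) q ((s, w) :: (t ++ t'))
  | discard {p q : M.State} {z : M.Stack} {v : List M.Stack}
      {t : List (Option (TapeSymbol α) × ω)} :
      p ∈ M.acc → Pops M p v q t → Pops M p (z :: v) q t

variable {M : NPDA α ω}

/-- Accepting states halt, so after acceptance only discarding remains. Discarding reconciles
acceptance by state, with symbols left on the stack, with a grammar that needs the stack emptied. -/
theorem Pops.of_acc {p q : M.State} {v : List M.Stack} {t : List (Option (TapeSymbol α) × ω)}
    (h : M.Pops p v q t) (hp : p ∈ M.acc) : q = p ∧ t = [] := by
  induction h with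
  | nil => exact ⟨rfl, rfl⟩
  | step h => exact absurd (Or.inl hp) h
  | discard _ _ ih => exact ih hp

theorem Pops.discard_all {q : M.State} (hq : q ∈ M.acc) (v : List M.Stack) : M.Pops q v q [] := by
  induction v with
  | nil => exact .nil q
  | cons z v ih => exact .discard hq ih

theorem Pops.append_split {p q : M.State} {v v' : List M.Stack}
    {t : List (Option (TapeSymbol α) × ω)} (h : M.Pops p (v ++ v') q t) :
    ∃ r t₁ t₂, M.Pops p v r t₁ ∧ M.Pops r v' q t₂ ∧ t = t₁ ++ t₂ := by
  generalize hu : v ++ v' = u at h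
  induction h generalizing v with
  | nil p =>
    obtain ⟨rfl, rfl⟩ := List.append_eq_nil_iff.1 hu
    exact ⟨p, [], [], .nil p, .nil p, rfl⟩
  | @step p p' r q s z β w e t t' hp ht h₁ h₂ _ ih =>
    cases v with
    | nil => exact ⟨p, [], _, .nil p, by subst hu; exact .step hp ht h₁ h₂, rfl⟩
    | cons y v =>
      cases hu
      obtain ⟨r', t₁, t₂, h₃, h₄, rfl⟩ := ih rfl
      exact ⟨r', _, t₂, .step hp ht h₁ h₃, h₄, by simp⟩
  | @discard p q z w t hp h ih =>
    cases v with
    | nil => exact ⟨p, [], _, .nil p, by subst hu; exact .discard hp h, rfl⟩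
    | cons y v =>
      cases hu
      obtain ⟨r', t₁, t₂, h₃, h₄, rfl⟩ := ih rfl
      exact ⟨r', _, t₂, .discard hp h₃, h₄, rfl⟩

theorem Run.exists_pops {c c' : M.Config} {l : List ω} (h : M.Run c l c') (hc : c'.state ∈ M.acc) :
    ∃ t, M.Pops c.state c.stack c'.state t ∧ l = t.map Prod.snd ∧
      c.input = t.filterMap Prod.fst ++ c'.input := by
  induction h with
  | nil c => exact ⟨[], Pops.discard_all hc _, rfl, rfl⟩
  | cons hs _ ih =>
    obtain ⟨t, ht, rfl, hu⟩ := ih hc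
    cases hs with
    | read hq hm =>
      obtain ⟨r, t₁, t₂, h₁, h₂, rfl⟩ := ht.append_split
      exact ⟨_, .step hq hm h₁ h₂, rfl, congrArg _ hu⟩
    | silent hq hm =>
      obtain ⟨r, t₁, t₂, h₁, h₂, rfl⟩ := ht.append_split
      exact ⟨_, .step hq hm h₁ h₂, rfl, hu⟩

/-- The disjunction covers a run that accepts before `v` is used up: discarded symbols are not
removed by any move, so the final stack is then unspecified. -/
theorem Pops.exists_run {p q : M.State} {v : List M.Stack} {t : List (Option (TapeSymbol α) × ω)}
    (h : M.Pops p v q t) (u : List (TapeSymbol α)) (v₀ : List M.Stack) :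
    ∃ v', M.Run ⟨p, t.filterMap Prod.fst ++ u, v ++ v₀⟩ (t.map Prod.snd) ⟨q, u, v'⟩ ∧
      (v' = v₀ ∨ q ∈ M.acc) := by
  induction h generalizing u v₀ with
  | nil p => exact ⟨v₀, .nil _, .inl rfl⟩
  | @step p p' r q s z β v w t t' hp hm h₁ h₂ ih₁ ih₂ =>
    obtain ⟨v₁, hr₁, hv₁⟩ := ih₁ (t'.filterMap Prod.fst ++ u) (v ++ v₀)
    have hs : M.Step ⟨p, ((s, w) :: (t ++ t')).filterMap Prod.fst ++ u, z :: v ++ v₀⟩ w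
        ⟨p', t.filterMap Prod.fst ++ (t'.filterMap Prod.fst ++ u), β ++ (v ++ v₀)⟩ := by
      cases s with
      | none => simpa using Step.silent (u := t.filterMap Prod.fst ++
          (t'.filterMap Prod.fst ++ u)) (v := v ++ v₀) hp hm
      | some s => simpa using Step.read (u := t.filterMap Prod.fst ++
          (t'.filterMap Prod.fst ++ u)) (v := v ++ v₀) hp hm
    rcases hv₁ with rfl | hr
    · obtain ⟨v₂, hr₂, hv₂⟩ := ih₂ u v₀
      exact ⟨v₂, by simpa using Run.cons hs (hr₁.append hr₂), hv₂⟩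
    · obtain ⟨rfl, rfl⟩ := h₂.of_acc hr
      exact ⟨v₁, by simpa using Run.cons hs hr₁, .inr hr⟩
  | @discard p q z v t hp h ih =>
    obtain ⟨rfl, rfl⟩ := h.of_acc hp
    exact ⟨_, .nil _, .inr hp⟩

/-- The letters of the accepting computations, on arbitrary inputs. -/
def traces (M : NPDA α ω) : Language (Option (TapeSymbol α) × ω) :=
  {t | ∃ q ∈ M.acc, M.Pops M.start [M.bottom] q t}

/-- The triple construction, with nonterminals `(p, v, q)` generating the words `t` with `M.Pops p v
q t`, where `v` is a whole string of stack symbols. -/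
theorem traces_isContextFree [Finite α] [Finite ω] (M : NPDA α ω) :
    M.traces.IsContextFree := by
  have := M.finite_state
  have := M.finite_stack
  let pushed : Set (List M.Stack) :=
    {[M.bottom]} ∪ ⋃ p : M.State × Option (TapeSymbol α) × M.Stack,
      (fun m => m.2.1) '' M.trans p.1 p.2.1 p.2.2
  have hpushed : pushed.Finite := (Set.finite_singleton _).union
    (Set.finite_iUnion fun p => (M.finite_trans _ _ _).image _)
  -- Suffixes of strings pushed in one move, or of the initial stack, are the only strings that
  -- occur in the recursion; restricting to them keeps the rules finite in number.
  let S : Set (List M.Stack) := {v | ∃ β ∈ pushed, v <:+ β}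
  have hS : S.Finite := by
    refine (hpushed.biUnion fun β _ => β.tails.finite_toSet).subset ?_
    rintro v ⟨β, hβ, hv⟩
    exact Set.mem_biUnion hβ ((List.mem_tails _ _).2 hv)
  have hS_tail : ∀ z v, z :: v ∈ S → v ∈ S := by
    rintro z v ⟨β, hβ, hv⟩
    exact ⟨β, hβ, (List.suffix_cons z v).trans hv⟩
  have hS_trans : ∀ p s z p' β w, (p', β, w) ∈ M.trans p s z → β ∈ S := fun p s z p' β w h =>
    ⟨β, .inr (Set.mem_iUnion.2 ⟨(p, s, z), _, h, rfl⟩), List.suffix_rfl⟩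
  let N := Option (M.State × List M.Stack × M.State)
  let R : N → List (Symbol (Option (TapeSymbol α) × ω) N) → Prop := fun A rhs =>
    match A with
    | none => ∃ q ∈ M.acc, rhs = [.nonterminal (some (M.start, [M.bottom], q))]
    | some (p, [], q) => p = q ∧ rhs = []
    | some (p, z :: v, q) => z :: v ∈ S ∧
      ((p ∈ M.acc ∧ rhs = [.nonterminal (some (p, v, q))]) ∨
      ∃ p' r s β w, p ∉ M.halt ∧ (p', β, w) ∈ M.trans p s z ∧
        rhs = [.terminal (s, w), .nonterminal (some (p', β, r)), .nonterminal (some (r, v, q))])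
  have hSf := hS.to_subtype
  have hR : {p : N × List (Symbol (Option (TapeSymbol α) × ω) N) | R p.1 p.2}.Finite := by
    refine (((Set.finite_range fun q => ((none : N),
      [Symbol.nonterminal (some (M.start, [M.bottom], q))])).union
      (Set.finite_range fun p => ((some (p, [], p) : N), []))).union
      ((Set.finite_range fun a : M.State × M.Stack × S × M.State =>
        ((some (a.1, a.2.1 :: a.2.2.1.1, a.2.2.2) : N),
          [Symbol.nonterminal (some (a.1, a.2.2.1.1, a.2.2.2))])).union
      (Set.finite_range fun a : (M.State × M.Stack × S × M.State) ×
          M.State × M.State × Option (TapeSymbol α) × S × ω =>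
        ((some (a.1.1, a.1.2.1 :: a.1.2.2.1.1, a.1.2.2.2) : N),
          [Symbol.terminal (a.2.2.2.1, a.2.2.2.2.2),
            .nonterminal (some (a.2.1, a.2.2.2.2.1.1, a.2.2.1)),
            .nonterminal (some (a.2.2.1, a.1.2.2.1.1, a.1.2.2.2))])))).subset ?_
    rintro ⟨_ | ⟨p, _ | ⟨z, v⟩, q⟩, rhs⟩ h
    · obtain ⟨q, -, rfl⟩ := h
      exact .inl (.inl ⟨q, rfl⟩)
    · obtain ⟨rfl, rfl⟩ := h
      exact .inl (.inr ⟨p, rfl⟩)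
    · obtain ⟨hv, ⟨-, rfl⟩ | ⟨p', r, s, β, w, -, hm, rfl⟩⟩ := h
      · exact .inr (.inl ⟨(p, z, ⟨v, hS_tail _ _ hv⟩, q), rfl⟩)
      · exact .inr (.inr ⟨((p, z, ⟨v, hS_tail _ _ hv⟩, q),
          p', r, s, ⟨β, hS_trans _ _ _ _ _ _ hm⟩, w), rfl⟩)
  refine isContextFree_of_rules R hR none fun t => ?_
  constructor
  · rintro ⟨q, hq, h⟩
    refine Parse.singleton_iff.2 ⟨_, ⟨q, hq, rfl⟩, ?_⟩
    have key : ∀ p v q t, M.Pops p v q t → v ∈ S → Parse R [.nonterminal (some (p, v, q))] t := by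
      intro p v q t h
      induction h with
      | nil p => exact fun _ => Parse.singleton_iff.2 ⟨[], ⟨rfl, rfl⟩, .nil⟩
      | @step p p' r q s z β v w t t' hp hm _ _ ih₁ ih₂ =>
        intro hv
        refine Parse.singleton_iff.2 ⟨_, ⟨hv, .inr ⟨p', r, s, β, w, hp, hm, rfl⟩⟩, .term ?_⟩
        exact Parse.append_iff (β := [_]).2
          ⟨_, _, ih₁ (hS_trans _ _ _ _ _ _ hm), ih₂ (hS_tail _ _ hv), rfl⟩
      | discard hp _ ih =>
        intro hv
        exact Parse.singleton_iff.2 ⟨_, ⟨hv, .inl ⟨hp, rfl⟩⟩, ih (hS_tail _ _ hv)⟩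
    exact key _ _ _ _ h ⟨_, .inl rfl, List.suffix_rfl⟩
  · intro h
    let I : N → List (Option (TapeSymbol α) × ω) → Prop := fun A t =>
      match A with
      | none => ∃ q ∈ M.acc, M.Pops M.start [M.bottom] q t
      | some (p, v, q) => M.Pops p v q t
    have hI : ∀ A rhs s, R A rhs → Interprets I rhs s → I A s := by
      rintro (_ | ⟨p, _ | ⟨z, v⟩, q⟩) rhs s h hs
      · obtain ⟨q, hq, rfl⟩ := h
        obtain ⟨u, _, hu, rfl, rfl⟩ := hs
        exact ⟨q, hq, by simpa using hu⟩
      · obtain ⟨rfl, rfl⟩ := h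
        obtain rfl := hs
        exact .nil p
      · obtain ⟨hv, ⟨hp, rfl⟩ | ⟨p', r, s, β, w, hp, hm, rfl⟩⟩ := h
        · obtain ⟨u, _, hu, rfl, rfl⟩ := hs
          exact .discard hp (by simpa using hu)
        · obtain ⟨_, rfl, u, _, hu, ⟨u', _, hu', rfl, rfl⟩, rfl⟩ := hs
          have := Pops.step hp hm hu hu'
          simpa using this
    obtain ⟨u, _, hu, rfl, rfl⟩ := h.interprets hI
    rw [List.append_nil]
    exact hu

end NPDA

/-! ### Computation histories that record the whole tape. -/

/-- Lists of unread tape symbols, as letters of a computation history. -/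
def unread (α γ : Type) : Language (Option (TapeSymbol α) × Option γ) :=
  {r | ∀ d ∈ r, d.1.isSome ∧ d.2 = none}

/-- The computation histories of `M`: the letters of an accepting computation, followed by the
unread tape symbols. -/
def histories {α γ : Type} (M : NPDA α (Option γ)) : Language (Option (TapeSymbol α) × Option γ) :=
  M.traces * unread α γ

theorem histories_isContextFree {α γ : Type} [Finite α] [Finite γ] (M : NPDA α (Option γ)) :
    (histories M).IsContextFree := by
  refine IsContextFree.mul M.traces_isContextFree ?_
  let R : Unit → Option (Option (TapeSymbol α) × Option γ) →
      Option (Option (TapeSymbol α) × Option γ) → Unit → Prop :=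
    fun _ l r _ => (∃ d, l = some d ∧ d.1.isSome ∧ d.2 = none) ∧ r = none
  suffices h : unread α γ = ({s | Linear R (fun _ => True) () s} : Set _) from
    h ▸ Linear.isContextFree R (fun _ => True) ()
  ext s
  constructor
  · intro h
    induction s with
    | nil => exact .done trivial
    | cons d s ih =>
      have hd := h d (.head _)
      have := Linear.step (R := R) (q := ()) (l := some d) (r := none)
        ⟨⟨d, rfl, hd⟩, rfl⟩ (ih fun e he => h e (.tail _ he))
      change Linear R (fun _ => True) () (d :: s)
      simpa using this
  · intro h
    change Linear R (fun _ => True) () s at h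
    generalize () = q at h
    induction h with
    | done => intro d hd; cases hd
    | step h _ ih =>
      obtain ⟨⟨d, rfl, hd⟩, rfl⟩ := h
      intro e he
      simp only [Option.toList_some, Option.toList_none, List.append_nil, List.cons_append,
        List.nil_append, List.mem_cons] at he
      rcases he with rfl | he
      · exact hd
      · exact ih e he

/-- The machine may accept before the end of its tape; the part of the history after the trace is
what it leaves unread, and it carries no output. -/
theorem mem_outcomes_of_history {α γ : Type} {M : NPDA α (Option γ)} {x : List α}
    {w : List (Option (TapeSymbol α) × Option γ)} (hw : w ∈ histories M)
    (hx : w.filterMap Prod.fst = tape x) : w.filterMap Prod.snd ∈ M.outcomes x := by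
  obtain ⟨t, ⟨q, hq, ht⟩, r, hr, rfl⟩ := Language.mem_mul.1 hw
  obtain ⟨v', hrun, -⟩ := ht.exists_run (r.filterMap Prod.fst) []
  rw [← List.filterMap_append, hx] at hrun
  refine ⟨t.map Prod.snd, ⟨_, hrun, hq⟩, ?_⟩
  have h : r.filterMap Prod.snd = [] := List.filterMap_eq_nil_iff.2 fun d hd => (hr d hd).2
  rw [List.filterMap_append, h, List.append_nil, List.reduceOption, List.filterMap_map]
  rfl

theorem exists_history {α γ : Type} {M : NPDA α (Option γ)} (hM : M.Terminates) :
    ∃ a b : ℕ, ∀ x, ∀ y ∈ M.outcomes x, ∃ w ∈ histories M, w.filterMap Prod.fst = tape x ∧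
      w.filterMap Prod.snd = y ∧ w.length ≤ a * x.length + b := by
  obtain ⟨a, b, hab⟩ := hM
  -- The unread part adds at most `x.length + 2` letters, the 2 being for the endmarkers.
  refine ⟨a + 1, b + 2, ?_⟩
  rintro x y ⟨l, ⟨c, hrun, hc⟩, rfl⟩
  obtain ⟨t, ht, rfl, hu⟩ := hrun.exists_pops hc
  have hu : tape x = t.filterMap Prod.fst ++ c.input := hu
  have hl := (hab _ _ _ hrun).1
  refine ⟨t ++ c.input.map fun s => (some s, none), Language.append_mem_mul ⟨_, hc, ht⟩ ?_,
    ?_, ?_, ?_⟩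
  · intro d hd
    obtain ⟨s, -, rfl⟩ := List.mem_map.1 hd
    exact ⟨rfl, rfl⟩
  · rw [List.filterMap_append, hu, List.filterMap_map]
    congr 1
    exact List.filterMap_some
  · rw [List.filterMap_append, List.filterMap_map, List.reduceOption, List.filterMap_map]
    have : c.input.filterMap (Prod.snd ∘ fun s => (some s, (none : Option γ))) = [] :=
      List.filterMap_eq_nil_iff.2 fun _ _ => rfl
    rw [this, List.append_nil]
    rfl
  · have h₁ := congrArg List.length hu
    simp only [tape, List.length_cons, List.length_append, List.length_map, List.length_nil] at h₁
    simp only [List.length_append, List.length_map] at hl ⊢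
    rw [add_mul]
    omega

/-! ### An oracle npda that queries a guessed word and its reversal -/

/-- The query alphabet of the guessing npda: the tape symbols read, the letters guessed while
reading, and the letters popped after reading. -/
inductive QueryLetter (α Δ : Type) : Type
  | tape : TapeSymbol α → QueryLetter α Δ
  | fwd : Δ → QueryLetter α Δ
  | bwd : Δ → QueryLetter α Δ

namespace QueryLetter

variable {α Δ : Type}

instance [Finite α] [Finite Δ] : Finite (QueryLetter α Δ) :=
  Finite.of_surjective (fun o : TapeSymbol α ⊕ Δ ⊕ Δ => match o with
    | .inl s => QueryLetter.tape s
    | .inr (.inl d) => QueryLetter.fwd d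
    | .inr (.inr d) => QueryLetter.bwd d) fun
    | .tape s => ⟨.inl s, rfl⟩
    | .fwd d => ⟨.inr (.inl d), rfl⟩
    | .bwd d => ⟨.inr (.inr d), rfl⟩

/-- The tape symbol recorded by a letter. -/
def tape? : QueryLetter α Δ → Option (TapeSymbol α)
  | tape s => some s
  | _ => none

/-- The letter guessed while reading. -/
def fwd? : QueryLetter α Δ → Option Δ
  | fwd d => some d
  | _ => none

/-- The letter popped after reading. -/
def bwd? : QueryLetter α Δ → Option Δ
  | bwd d => some d
  | _ => none

/-- The query whose first half is `s`: the letters guessed in `s` follow in reverse order. -/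
def query (s : List (QueryLetter α Δ)) : List (QueryLetter α Δ) :=
  s ++ (s.filterMap fwd?).reverse.map bwd

theorem filterMap_map_append_of_none {β : Type} {f : QueryLetter α Δ → Option β}
    {g : Δ → QueryLetter α Δ} (h : ∀ d, f (g d) = none) (P : List Δ) (s : List (QueryLetter α Δ)) :
    (P.map g ++ s).filterMap f = s.filterMap f := by
  simp [List.filterMap_map, h]

end QueryLetter

theorem right_notMem {α : Type} (x : List α) :
    TapeSymbol.right ∉ TapeSymbol.left :: x.map TapeSymbol.sym := by
  simp

open QueryLetter hiding tape

/-- The states of the guessing npda: reading the input with a remaining budget of guesses, popping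
the stack, and accepting. -/
inductive GuessState (K : ℕ) : Type
  | read : Fin (K + 1) → GuessState K
  | pop : GuessState K
  | accept : GuessState K

instance (K : ℕ) : Finite (GuessState K) :=
  Finite.of_surjective (fun o : Option (Option (Fin (K + 1))) => match o with
    | none => GuessState.accept
    | some none => GuessState.pop
    | some (some k) => GuessState.read k) fun
    | .accept => ⟨none, rfl⟩
    | .pop => ⟨some none, rfl⟩
    | .read k => ⟨some (some k), rfl⟩

/-- The moves of the guessing npda. -/
inductive GuessMove (α Δ : Type) (K : ℕ) : GuessState K → Option (TapeSymbol α) → Option Δ →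
    GuessState K × List (Option Δ) × (Option (Fin 2) × Option (QueryLetter α Δ)) → Prop
  | guess {k k' : Fin (K + 1)} (h : (k : ℕ) = k' + 1) (d : Δ) (z : Option Δ) :
      GuessMove α Δ K (.read k) none z (.read k', [some d, z], none, some (.fwd d))
  | symbol (k : Fin (K + 1)) {s : TapeSymbol α} (hs : s ≠ .right) (z : Option Δ) :
      GuessMove α Δ K (.read k) (some s) z (.read (Fin.last K), [z], none, some (.tape s))
  | turn (k : Fin (K + 1)) (z : Option Δ) :
      GuessMove α Δ K (.read k) (some .right) z (.pop, [z], none, some (.tape .right))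
  | pop (d : Δ) : GuessMove α Δ K .pop none (some d) (.pop, [], none, some (.bwd d))
  | finish : GuessMove α Δ K .pop none none (.accept, [], some 1, none)

/-- The npda that copies its input tape to the query tape, guesses up to `K` letters after each
tape symbol, and finally repeats its guesses in reverse order. -/
def guesser (α Δ : Type) [Finite α] [Finite Δ] (K : ℕ) :
    NPDA α (Option (Fin 2) × Option (QueryLetter α Δ)) where
  State := GuessState K
  Stack := Option Δ
  finite_state := inferInstance
  finite_stack := inferInstance
  -- With budget 0 nothing is guessed before the left endmarker is read; that endmarker and each
  -- input symbol then grant `K` guesses, `K * (x.length + 1)` in all.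
  start := .read 0
  bottom := none
  acc := {.accept}
  rej := ∅
  disjoint_acc_rej := Set.disjoint_empty _
  trans q s z := {m | GuessMove α Δ K q s z m}
  finite_trans q s z := by
    refine (Set.finite_univ.prod ((List.finite_length_le (Option Δ) 2).prod
      Set.finite_univ)).subset ?_
    rintro ⟨q', β, w⟩ h
    refine ⟨trivial, ?_, trivial⟩
    cases h <;> simp

namespace Guesser

variable {α Δ : Type} [Finite α] [Finite Δ] {K : ℕ}

/-- The configurations of the guessing npda. -/
abbrev conf (K : ℕ) (q : GuessState K) (u : List (TapeSymbol α)) (v : List (Option Δ)) :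
    (guesser α Δ K).Config := ⟨q, u, v⟩

theorem read_not_halt (k : Fin (K + 1)) :
    (GuessState.read k : (guesser α Δ K).State) ∉ (guesser α Δ K).halt := by
  rintro (h | h) <;> cases h

theorem pop_not_halt : (GuessState.pop : (guesser α Δ K).State) ∉ (guesser α Δ K).halt := by
  rintro (h | h) <;> cases h

/-- A bound for the number of remaining moves. -/
def potential (c : (guesser α Δ K).Config) : ℕ :=
  match c with
  -- A unit of budget weighs 2, to pay for the guess and for the later pop; a tape symbol outweighs
  -- the budget `2 * K` that it may restore.
  | ⟨.read k, u, v⟩ => 2 * (k : ℕ) + v.length + (2 * K + 2) * u.length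
  | ⟨.pop, _, v⟩ => v.length
  | ⟨.accept, _, _⟩ => 0

/-- The shape of the reachable configurations. -/
inductive Reachable : (guesser α Δ K).Config → Prop
  | read (k : Fin (K + 1)) {u u' : List (TapeSymbol α)} {z : Option Δ} {v : List (Option Δ)}
      {P : List Δ} (hu : TapeSymbol.right ∉ u) (hu' : u' = u ++ [.right])
      (hP : z :: v = P.map some ++ [none]) : Reachable (conf K (.read k) u' (z :: v))
  | pop {v : List (Option Δ)} {P : List Δ} (hP : v = P.map some ++ [none]) :
      Reachable (conf K .pop [] v)
  | accept : Reachable (conf K .accept [] [])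

/-- Inversion of the moves of the guessing npda. -/
inductive Move : (guesser α Δ K).Config → Option (Fin 2) × Option (QueryLetter α Δ) →
    (guesser α Δ K).Config → Prop
  | guess {k k' : Fin (K + 1)} (h : (k : ℕ) = k' + 1) (d : Δ) (u : List (TapeSymbol α))
      (z : Option Δ) (v : List (Option Δ)) :
      Move (conf K (.read k) u (z :: v)) (none, some (.fwd d))
        (conf K (.read k') u (some d :: z :: v))
  | symbol (k : Fin (K + 1)) {s : TapeSymbol α} (hs : s ≠ .right) (u : List (TapeSymbol α))
      (z : Option Δ) (v : List (Option Δ)) :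
      Move (conf K (.read k) (s :: u) (z :: v)) (none, some (.tape s))
        (conf K (.read (Fin.last K)) u (z :: v))
  | turn (k : Fin (K + 1)) (u : List (TapeSymbol α)) (z : Option Δ) (v : List (Option Δ)) :
      Move (conf K (.read k) (.right :: u) (z :: v)) (none, some (.tape .right))
        (conf K .pop u (z :: v))
  | pop (d : Δ) (u : List (TapeSymbol α)) (v : List (Option Δ)) :
      Move (conf K .pop u (some d :: v)) (none, some (.bwd d)) (conf K .pop u v)
  | finish (u : List (TapeSymbol α)) (v : List (Option Δ)) :
      Move (conf K .pop u (none :: v)) (some 1, none) (conf K .accept u v)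

theorem step_iff {c c' : (guesser α Δ K).Config}
    {w : Option (Fin 2) × Option (QueryLetter α Δ)} :
    (guesser α Δ K).Step c w c' ↔ Move c w c' := by
  constructor
  · intro h
    cases h with
    | @read q q' s u z v β w hq hm =>
      change GuessMove α Δ K q (some s) z (q', β, w) at hm
      cases hm with
      | symbol k hs => exact .symbol k hs u z v
      | turn k => exact .turn k u z v
    | @silent q q' u z v β w hq hm =>
      change GuessMove α Δ K q none z (q', β, w) at hm
      cases hm with
      | guess h d => exact .guess h d u z v
      | pop d => exact .pop d u v
      | finish => exact .finish u v
  · intro h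
    cases h with
    | guess h d u z v =>
      exact NPDA.Step.silent (M := guesser α Δ K) (read_not_halt _) (GuessMove.guess h d z)
    | symbol k hs u z v =>
      exact NPDA.Step.read (M := guesser α Δ K) (read_not_halt _) (GuessMove.symbol k hs z)
    | turn k u z v =>
      exact NPDA.Step.read (M := guesser α Δ K) (read_not_halt _) (GuessMove.turn k z)
    | pop d u v => exact NPDA.Step.silent (M := guesser α Δ K) pop_not_halt (GuessMove.pop d)
    | finish u v => exact NPDA.Step.silent (M := guesser α Δ K) pop_not_halt GuessMove.finish

theorem Reachable.step {c c' : (guesser α Δ K).Config}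
    {w : Option (Fin 2) × Option (QueryLetter α Δ)} (hc : Reachable c)
    (h : (guesser α Δ K).Step c w c') : Reachable c' ∧ potential c' + 1 ≤ potential c := by
  rw [step_iff] at h
  cases h with
  | @guess k k' h d u z v =>
    cases hc with
    | @read _ u _ _ _ P hu hu' hP =>
      refine ⟨.read (P := d :: P) k' hu hu' (congrArg (some d :: ·) hP), ?_⟩
      change 2 * (k' : ℕ) + (v.length + 1 + 1) + _ + 1 ≤ 2 * (k : ℕ) + (v.length + 1) + _
      omega
  | symbol k hs U z v =>
    cases hc with
    | @read _ u _ _ _ P hu hu' hP =>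
      cases u with
      | nil => cases hu'; exact absurd rfl hs
      | cons s u =>
        cases hu'
        refine ⟨.read (P := P) _ (fun h => hu (.tail _ h)) rfl hP, ?_⟩
        change 2 * K + (v.length + 1) + (2 * K + 2) * (u ++ [TapeSymbol.right]).length + 1 ≤
          2 * (k : ℕ) + (v.length + 1) + (2 * K + 2) * ((u ++ [TapeSymbol.right]).length + 1)
        rw [mul_add]
        omega
  | turn k U z v =>
    cases hc with
    | @read _ u _ _ _ P hu hu' hP =>
      cases u with
      | cons s u => cases hu'; exact absurd (.head _) hu
      | nil =>
        cases hu'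
        refine ⟨.pop hP, ?_⟩
        change v.length + 1 + 1 ≤ 2 * (k : ℕ) + (v.length + 1) + (2 * K + 2) * 1
        omega
  | pop d u v =>
    cases hc with
    | @pop _ P hP =>
      cases P with
      | nil => cases hP
      | cons d' P =>
        cases hP
        exact ⟨.pop rfl, le_rfl⟩
  | finish u v =>
    cases hc with
    | @pop _ P hP =>
      cases P with
      | cons d' P => cases hP
      | nil =>
        cases hP
        exact ⟨.accept, le_rfl⟩

theorem Reachable.exists_step {c : (guesser α Δ K).Config} (hc : Reachable c)
    (h : c.state ∉ (guesser α Δ K).halt) : ∃ w c', (guesser α Δ K).Step c w c' := by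
  simp only [step_iff]
  cases hc with
  | @read k u _ z v P hu hu' hP =>
    cases u with
    | nil => cases hu'; exact ⟨_, _, .turn k [] z v⟩
    | cons s u =>
      cases hu'
      change ∃ w c', Move (conf K (.read k) (s :: (u ++ [TapeSymbol.right])) (z :: v)) w c'
      exact ⟨_, _, .symbol k (fun h => hu (h ▸ .head _)) (u ++ [TapeSymbol.right]) z v⟩
  | @pop v P hP =>
    subst hP
    cases P with
    | nil => exact ⟨_, _, .finish _ _⟩
    | cons d P => exact ⟨_, _, .pop d _ _⟩
  | accept => exact absurd (Or.inl rfl) h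

theorem Reachable.run {c c' : (guesser α Δ K).Config}
    {l : List (Option (Fin 2) × Option (QueryLetter α Δ))} (hc : Reachable c)
    (h : (guesser α Δ K).Run c l c') : Reachable c' ∧ potential c' + l.length ≤ potential c := by
  induction h with
  | nil => exact ⟨hc, le_rfl⟩
  | cons hs _ ih =>
    obtain ⟨h₁, h₂⟩ := hc.step hs
    obtain ⟨h₃, h₄⟩ := ih h₁
    exact ⟨h₃, by rw [List.length_cons]; omega⟩

theorem terminates : (guesser α Δ K).Terminates := by
  -- The value of `potential` at the start: the constant term comes from two endmarkers and the
  -- bottom marker.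
  refine ⟨2 * K + 2, 2 * (2 * K + 2) + 1, fun x l c h => ?_⟩
  have h₀ : Reachable ((guesser α Δ K).init x) := .read (P := []) 0 (right_notMem x) rfl rfl
  obtain ⟨h₁, h₂⟩ := h₀.run h
  refine ⟨?_, h₁.exists_step⟩
  have h₃ : potential ((guesser α Δ K).init x) =
      (2 * K + 2) * x.length + (2 * (2 * K + 2) + 1) := by
    change 2 * 0 + 1 + (2 * K + 2) * List.length (_ :: _) = _
    simp only [List.length_cons, List.length_append, List.length_map, List.length_nil]
    ring
  omega

theorem run_accept {u : List (TapeSymbol α)} {v : List (Option Δ)}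
    {c' : (guesser α Δ K).Config} {l : List (Option (Fin 2) × Option (QueryLetter α Δ))}
    (h : (guesser α Δ K).Run (conf K .accept u v) l c') : l = [] := by
  cases h with
  | nil => rfl
  | cons hs => cases step_iff.1 hs

theorem run_pop {P : List Δ} {c c' : (guesser α Δ K).Config}
    {l : List (Option (Fin 2) × Option (QueryLetter α Δ))} (h : (guesser α Δ K).Run c l c')
    (hc' : c'.state = GuessState.accept) (hc : c = conf K .pop [] (P.map some ++ [none])) :
    (l.map Prod.snd).reduceOption = P.map bwd ∧ (l.map Prod.fst).reduceOption = [1] := by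
  induction h generalizing P with
  | nil => subst hc; cases hc'
  | cons hs hr ih =>
    subst hc
    cases P with
    | nil =>
      cases step_iff.1 hs
      cases run_accept hr
      exact ⟨rfl, rfl⟩
    | cons d P =>
      cases step_iff.1 hs
      obtain ⟨h₁, h₂⟩ := ih hc' rfl
      exact ⟨congrArg (bwd d :: ·) h₁, h₂⟩

/-- `P` holds the earlier guesses still on the stack, latest first; they are popped after those made
in `s`, hence the suffix `P.map bwd`. -/
theorem run_read {P : List Δ} {k : Fin (K + 1)} {u u' : List (TapeSymbol α)}
    {v : List (Option Δ)} {c c' : (guesser α Δ K).Config}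
    {l : List (Option (Fin 2) × Option (QueryLetter α Δ))}
    (h : (guesser α Δ K).Run c l c') (hc' : c'.state = GuessState.accept)
    (hu : TapeSymbol.right ∉ u) (hu' : u' = u ++ [.right]) (hP : v = P.map some ++ [none])
    (hc : c = conf K (.read k) u' v) :
    ∃ s : List (QueryLetter α Δ), s.filterMap bwd? = [] ∧ s.filterMap tape? = u' ∧
      (l.map Prod.snd).reduceOption = query s ++ P.map bwd ∧
      (l.map Prod.fst).reduceOption = [1] := by
  induction h generalizing P k u u' v with
  | nil => subst hc; cases hc'
  | cons hs hr ih =>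
    subst hc
    have hs := step_iff.1 hs
    cases hs with
    | guess hk d u z v =>
      obtain ⟨s, h₁, h₂, h₃, h₄⟩ := ih (P := d :: P) hc' hu hu' (congrArg (some d :: ·) hP) rfl
      refine ⟨fwd d :: s, h₁, h₂, ?_, h₄⟩
      refine (congrArg (fwd d :: ·) h₃).trans ?_
      simp [query, fwd?]
    | @symbol k a hne U z v =>
      cases u with
      | nil => cases hu'; exact absurd rfl hne
      | cons b u =>
        cases hu'
        obtain ⟨s, h₁, h₂, h₃, h₄⟩ := ih hc' (fun h => hu (.tail _ h)) rfl hP rfl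
        exact ⟨QueryLetter.tape a :: s, h₁, congrArg (a :: ·) h₂,
          congrArg (QueryLetter.tape a :: ·) h₃, h₄⟩
    | turn k U z v =>
      cases u with
      | cons s u => cases hu'; exact absurd (.head _) hu
      | nil =>
        cases hu'
        obtain ⟨h₃, h₄⟩ := run_pop hr hc' (by rw [hP])
        exact ⟨[QueryLetter.tape .right], rfl, rfl, congrArg (QueryLetter.tape .right :: ·) h₃, h₄⟩

theorem exists_run_pop (P : List Δ) :
    (guesser α Δ K).Run (conf K .pop [] (P.map some ++ [none]))
      (P.map (fun d => (none, some (bwd d))) ++ [(some 1, none)]) (conf K .accept [] []) := by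
  induction P with
  | nil => exact .cons (step_iff.2 (.finish _ _)) (.nil _)
  | cons d P ih => exact .cons (step_iff.2 (.pop d _ _)) ih

theorem exists_run_guess (P : List Δ) (k : Fin (K + 1)) (hP : P.length ≤ k)
    (u : List (TapeSymbol α)) (z : Option Δ) (v : List (Option Δ)) :
    ∃ k' z' v', z' :: v' = P.reverse.map some ++ z :: v ∧
      (guesser α Δ K).Run (conf K (.read k) u (z :: v)) (P.map fun d => (none, some (fwd d)))
        (conf K (.read k') u (z' :: v')) := by
  induction P generalizing k z v with
  | nil => exact ⟨k, z, v, rfl, .nil _⟩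
  | cons d P ih =>
    rw [List.length_cons] at hP
    obtain ⟨k', z', v', h₁, h₂⟩ := ih ⟨k - 1, by omega⟩ (by simp only; omega) (some d) (z :: v)
    exact ⟨k', z', v', by simp [h₁], .cons (step_iff.2 (.guess (by simp only; omega) d u z v)) h₂⟩

theorem exists_run_read (u : List (TapeSymbol α)) (hu : TapeSymbol.right ∉ u) (P : List Δ)
    (hP : P.length ≤ K * u.length) (k : Fin (K + 1)) (z : Option Δ) (v : List (Option Δ)) :
    ∃ s : List (QueryLetter α Δ), s.filterMap bwd? = [] ∧ s.filterMap tape? = u ++ [.right] ∧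
      s.filterMap fwd? = P ∧
      (guesser α Δ K).Run (conf K (.read k) (u ++ [.right]) (z :: v))
        (s.map fun d => (none, some d)) (conf K .pop [] (P.reverse.map some ++ z :: v)) := by
  induction u generalizing P k z v with
  | nil =>
    obtain rfl : P = [] := List.length_eq_zero_iff.1 (Nat.le_zero.1 hP)
    exact ⟨[QueryLetter.tape .right], rfl, rfl, rfl, .cons (step_iff.2 (.turn k [] z v)) (.nil _)⟩
  | cons a u ih =>
    rw [List.length_cons, mul_add, mul_one] at hP
    -- After each symbol as many outstanding letters are guessed as the budget `K` allows.
    obtain ⟨k', z', v', h₁, h₂⟩ := exists_run_guess (α := α) (P.take K) (Fin.last K)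
      (by simp) (u ++ [.right]) z v
    obtain ⟨s, h₃, h₄, h₅, h₆⟩ := ih (fun h => hu (.tail _ h)) (P.drop K)
      (by rw [List.length_drop]; omega) k' z' v'
    refine ⟨QueryLetter.tape a :: ((P.take K).map fwd ++ s), ?_, ?_, ?_, ?_⟩
    · exact (filterMap_map_append_of_none (fun _ => rfl) _ _).trans h₃
    · exact congrArg (a :: ·) ((filterMap_map_append_of_none (fun _ => rfl) _ _).trans h₄)
    · refine (List.filterMap_append).trans ?_
      rw [h₅, List.filterMap_map, show fwd? ∘ (fwd : Δ → QueryLetter α Δ) = some from rfl,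
        List.filterMap_some, List.take_append_drop]
    · have h₇ := h₂.append h₆
      rw [h₁, ← List.append_assoc, ← List.map_append, ← List.reverse_append,
        List.take_append_drop] at h₇
      have h₈ := step_iff.2 (Move.symbol k (fun h => hu (h ▸ .head _)) (u ++ [TapeSymbol.right]) z v)
      refine NPDA.Run.cons h₈ ?_
      simpa [Function.comp_def] using h₇

end Guesser

/-- A language is many-one relative to `A` if its members are those inputs for which some guess of
linear length makes the query of the guessing npda belong to `A`. -/
theorem mem_CFLmOracle_of_query {α Δ : Type} [Finite α] [Finite Δ] {A : Language (QueryLetter α Δ)}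
    {L : Language α} (K : ℕ)
    (sound : ∀ x s, s.filterMap tape? = tape x → s.filterMap bwd? = [] → query s ∈ A → x ∈ L)
    (complete : ∀ x ∈ L, ∃ P : List Δ, P.length ≤ K * (x.length + 1) ∧
      ∀ s, s.filterMap tape? = tape x → s.filterMap bwd? = [] → s.filterMap fwd? = P →
        query s ∈ A) : L ∈ CFLmOracle A α := by
  refine ⟨⟨guesser α Δ K, Guesser.terminates, fun x => ?_⟩, ?_⟩
  · ext z
    constructor
    · rintro ⟨hx, rfl⟩
      obtain ⟨P, hP, h⟩ := complete x hx
      obtain ⟨s, h₁, h₂, h₃, h₄⟩ := Guesser.exists_run_read (K := K)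
        (TapeSymbol.left :: x.map TapeSymbol.sym) (right_notMem x) P (by simpa using hP)
        0 none []
      have h₅ := h₄.append (Guesser.exists_run_pop P.reverse)
      refine ⟨_, ⟨_, h₅, rfl⟩, ?_, ?_⟩
      · have h₆ := h s h₂ h₁ h₃
        rw [query, h₃] at h₆
        have e : ∀ (f : Δ → QueryLetter α Δ) (l : List Δ),
            (l.map fun d => some (f d)).reduceOption = l.map f := fun f l => by
          rw [List.reduceOption, List.filterMap_map]
          exact congrFun List.filterMap_eq_map l
        have e' : ∀ l : List (QueryLetter α Δ), (l.map some).reduceOption = l := fun l => by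
          rw [List.reduceOption, List.filterMap_map]
          exact List.filterMap_some
        simpa only [List.map_append, List.map_map, Function.comp_def, List.reduceOption_append, e,
          e', List.map_cons, List.map_nil, List.reduceOption_cons_of_none, List.reduceOption_nil,
          List.append_nil] using h₆
      · simp [List.reduceOption_append, Function.comp_def]
    · rintro ⟨l, ⟨c, hr, hc⟩, hA, rfl⟩
      obtain ⟨s, h₁, h₂, h₃, h₄⟩ := Guesser.run_read (P := []) hr hc (right_notMem x)
        rfl rfl rfl
      rw [List.map_nil, List.append_nil] at h₃
      exact ⟨sound x s h₂ h₁ (h₃ ▸ hA), h₄⟩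
  · rintro x _ ⟨-, rfl⟩ _ ⟨-, rfl⟩
    rfl

/-! ### Mirror languages -/

/-- `Path T q l`: the automaton with transitions `T` reads `l` from the state `q`. -/
def Path {δ Q : Type} (T : Q → δ → Q → Prop) : Q → List δ → Prop
  | _, [] => True
  | q, b :: l => ∃ q', T q b q' ∧ Path T q' l

theorem path_unit_iff {δ : Type} {ok : δ → Prop} {l : List δ} :
    Path (fun _ b (_ : Unit) => ok b) () l ↔ ∀ b ∈ l, ok b := by
  induction l with
  | nil => simp [Path]
  | cons b l ih => simp [Path, ih]

/-- The words `p ++ r.reverse` where `p` and `r` have the same keys, the letters of `p` are allowed,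
and `r` is read by an automaton. -/
def mirror {δ κ Q : Type} (ok : δ → Prop) (T : Q → δ → Q → Prop) (q : Q) (f g : δ → Option κ) :
    Language δ :=
  {s | ∃ p r, s = p ++ r.reverse ∧ (∀ a ∈ p, ok a) ∧ Path T q r ∧ p.filterMap f = r.filterMap g}

/-- A linear grammar works from the outside inwards: it emits a letter without key on either side,
or two letters with equal keys, one on each side. Its state is that of the automaton, which reads
`r` from the right end of the word. -/
theorem mirror_isContextFree {δ κ Q : Type} [Finite δ] [Finite Q] (ok : δ → Prop)
    (T : Q → δ → Q → Prop) (q : Q) (f g : δ → Option κ) : (mirror ok T q f g).IsContextFree := by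
  let R : Q → Option δ → Option δ → Q → Prop := fun q l r q' =>
    (∃ a, l = some a ∧ r = none ∧ q' = q ∧ ok a ∧ f a = none) ∨
    (∃ b, l = none ∧ r = some b ∧ T q b q' ∧ g b = none) ∨
    (∃ a b k, l = some a ∧ r = some b ∧ ok a ∧ T q b q' ∧ f a = some k ∧ g b = some k)
  suffices h : mirror ok T q f g = ({s | Linear R (fun _ => True) q s} : Set _) from
    h ▸ Linear.isContextFree R (fun _ => True) q
  ext s
  constructor
  · rintro ⟨p, r, rfl, hp, hr, hk⟩
    have erased : ∀ (p : List δ) (q : Q) (s : List δ), (∀ a ∈ p, ok a) → (∀ a ∈ p, f a = none) →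
        Linear R (fun _ => True) q s → Linear R (fun _ => True) q (p ++ s) := by
      intro p q s h₁ h₂ h
      induction p with
      | nil => exact h
      | cons a p ih =>
        simp only [List.mem_cons, forall_eq_or_imp] at h₁ h₂
        have := Linear.step (R := R) (l := some a) (r := none)
          (.inl ⟨a, rfl, rfl, rfl, h₁.1, h₂.1⟩) (ih h₁.2 h₂.2)
        simpa using this
    change Linear R (fun _ => True) q _
    induction r generalizing p q with
    | nil => exact erased p q [] hp (List.filterMap_eq_nil_iff.1 hk) (.done trivial)
    | cons b r ih =>
      obtain ⟨q', hb, hr⟩ := hr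
      cases hg : g b with
      | none =>
        rw [List.filterMap_cons_none hg] at hk
        have := Linear.step (R := R) (l := none) (r := some b)
          (.inr (.inl ⟨b, rfl, rfl, hb, hg⟩)) (ih q' p hp hr hk)
        simpa using this
      | some k =>
        rw [List.filterMap_cons_some hg] at hk
        obtain ⟨l₁, a, l₂, rfl, hl₁, ha, hl₂⟩ := List.filterMap_eq_cons_iff.1 hk
        have h₁ := ih q' l₂ (fun e he => hp e (by simp [he])) hr hl₂
        have h₂ := Linear.step (R := R) (l := some a) (r := some b)
          (.inr (.inr ⟨a, b, k, rfl, rfl, hp a (by simp), hb, ha, hg⟩)) h₁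
        have h₃ := erased l₁ q _ (fun e he => hp e (by simp [he])) hl₁ h₂
        simpa using h₃
  · intro h
    change Linear R (fun _ => True) q s at h
    induction h with
    | done => exact ⟨[], [], rfl, by simp, trivial, rfl⟩
    | step h _ ih =>
      obtain ⟨p, r, rfl, hp, hr, hk⟩ := ih
      rcases h with ⟨a, rfl, rfl, rfl, ha, hf⟩ | ⟨b, rfl, rfl, hb, hg⟩ |
        ⟨a, b, k, rfl, rfl, ha, hb, hf, hg⟩
      · exact ⟨a :: p, r, by simp, by simpa using ⟨ha, hp⟩, hr, by
          rw [List.filterMap_cons_none hf, hk]⟩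
      · exact ⟨p, b :: r, by simp, hp, ⟨_, hb, hr⟩, by rw [List.filterMap_cons_none hg, hk]⟩
      · exact ⟨a :: p, b :: r, by simp, by simpa using ⟨ha, hp⟩, ⟨_, hb, hr⟩, by
          rw [List.filterMap_cons_some hf, List.filterMap_cons_some hg, hk]⟩

/-! ### Two-track strings -/

/-- The automaton of the two-track strings; a state says on which tracks the padding has not yet
begun. -/
def TrackStep {α γ : Type} (q : Bool × Bool) (d : Option α × Option γ) (q' : Bool × Bool) : Prop :=
  q' = (d.1.isSome, d.2.isSome) ∧ (d.1.isSome → q.1) ∧ (d.2.isSome → q.2) ∧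
    (d.1.isSome ∨ d.2.isSome)

section Track

variable {α γ : Type}

theorem filterMap_fst_track (x : List α) (y : List γ) : (track x y).filterMap Prod.fst = x := by
  induction x generalizing y with
  | nil => simp [track, List.filterMap_map]
  | cons a x ih =>
    cases y with
    | nil => simp [track, List.filterMap_map]
    | cons b y => simpa [track] using ih y

theorem filterMap_snd_track (x : List α) (y : List γ) : (track x y).filterMap Prod.snd = y := by
  induction x generalizing y with
  | nil => simp [track, List.filterMap_map]
  | cons a x ih =>
    cases y with
    | nil => simp [track, List.filterMap_map]
    | cons b y => simpa [track] using ih y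

theorem length_track_le (x : List α) (y : List γ) :
    (track x y).length ≤ x.length + y.length := by
  induction x generalizing y with
  | nil => simp [track]
  | cons a x ih =>
    cases y with
    | nil => simp [track]
    | cons b y =>
      have := ih y
      simp only [track, List.zipWithAll_cons_cons, List.length_cons] at this ⊢
      omega

theorem path_track (x : List α) (y : List γ) (q : Bool × Bool) (hx : q.1 = false → x = [])
    (hy : q.2 = false → y = []) : Path TrackStep q (track x y) := by
  induction x generalizing y q with
  | nil =>
    induction y generalizing q with
    | nil => trivial
    | cons b y ih =>
      refine ⟨(false, true), ⟨rfl, by simp, fun _ => ?_, by simp⟩, ih _ (by simp) (by simp)⟩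
      by_contra h
      simpa using hy (by simpa using h)
  | cons a x ih =>
    have hq : q.1 = true := by
      by_contra h
      simpa using hx (by simpa using h)
    cases y with
    | nil =>
      refine ⟨(true, false), ⟨rfl, fun _ => hq, by simp, by simp⟩, ?_⟩
      have := ih [] (true, false) (by simp) (by simp)
      simpa [track] using this
    | cons b y =>
      refine ⟨(true, true), ⟨rfl, fun _ => hq, fun _ => ?_, by simp⟩,
        ih y (true, true) (by simp) (by simp)⟩
      by_contra h
      simpa using hy (by simpa using h)

/-- Once a finite automaton has checked the padding, a two-track string is determined by its tracks.
The oracles can therefore compare the tracks separately. -/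
theorem eq_track_of_path {u : List (Option α × Option γ)} {q : Bool × Bool}
    (h : Path TrackStep q u) :
    u = track (u.filterMap Prod.fst) (u.filterMap Prod.snd) ∧
      (q.1 = false → u.filterMap Prod.fst = []) ∧ (q.2 = false → u.filterMap Prod.snd = []) := by
  induction u generalizing q with
  | nil => exact ⟨rfl, fun _ => rfl, fun _ => rfl⟩
  | cons d u ih =>
    obtain ⟨q', ⟨rfl, h₁, h₂, h₃⟩, h⟩ := h
    obtain ⟨e, hx, hy⟩ := ih h
    obtain ⟨a, b⟩ := d
    cases a with
    | none =>
      cases b with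
      | none => simp at h₃
      | some b =>
        have hx := hx rfl
        rw [hx] at e
        refine ⟨?_, fun _ => ?_, fun hq => ?_⟩
        · simp only [List.filterMap_cons, hx]
          conv_lhs => rw [e]
          rfl
        · simpa [List.filterMap_cons] using hx
        · simp [hq] at h₂
    | some a =>
      have hq₁ : q.1 = true := h₁ rfl
      cases b with
      | none =>
        have hy := hy rfl
        rw [hy] at e
        refine ⟨?_, fun hq => ?_, fun _ => ?_⟩
        · simp only [List.filterMap_cons, hy]
          conv_lhs => rw [e]
          simp [track]
        · simp [hq] at hq₁
        · simpa [List.filterMap_cons] using hy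
      | some b =>
        have hq₂ : q.2 = true := h₂ rfl
        refine ⟨?_, fun hq => ?_, fun hq => ?_⟩
        · simp only [List.filterMap_cons]
          conv_lhs => rw [e]
          rfl
        · simp [hq] at hq₁
        · simp [hq] at hq₂

end Track

/-! ### The oracles -/

/-- The letters guessed by the oracle npda: a two-track string, a reversed computation history and
the computation history itself. -/
inductive GuessLetter (α γ : Type) : Type
  | pair : Option α × Option γ → GuessLetter α γ
  | rev : Option (TapeSymbol α) × Option γ → GuessLetter α γ
  | hist : Option (TapeSymbol α) × Option γ → GuessLetter α γ

namespace GuessLetter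

variable {α γ : Type}

instance [Finite α] [Finite γ] : Finite (GuessLetter α γ) :=
  Finite.of_surjective (fun o : (Option α × Option γ) ⊕ (Option (TapeSymbol α) × Option γ) ⊕
      (Option (TapeSymbol α) × Option γ) => match o with
    | .inl d => GuessLetter.pair d
    | .inr (.inl d) => GuessLetter.rev d
    | .inr (.inr d) => GuessLetter.hist d) fun
    | .pair d => ⟨.inl d, rfl⟩
    | .rev d => ⟨.inr (.inl d), rfl⟩
    | .hist d => ⟨.inr (.inr d), rfl⟩

/-- The letter of the two-track string. -/
def pair? : GuessLetter α γ → Option (Option α × Option γ)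
  | pair d => some d
  | _ => none

/-- The letter of the reversed history. -/
def rev? : GuessLetter α γ → Option (Option (TapeSymbol α) × Option γ)
  | rev d => some d
  | _ => none

/-- The letter of the history. -/
def hist? : GuessLetter α γ → Option (Option (TapeSymbol α) × Option γ)
  | hist d => some d
  | _ => none

end GuessLetter

open GuessLetter

/-- The input symbol read in a letter of a computation history. -/
def inputSymbol {α γ : Type} : Option (TapeSymbol α) × Option γ → Option α
  | (some (.sym a), _) => some a
  | _ => none

section Oracles

variable {α γ : Type}

/-- The letters written while the input is read, with a restriction on the guesses. -/
def FwdOk (p : GuessLetter α γ → Prop) (d : QueryLetter α (GuessLetter α γ)) : Prop :=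
  d.bwd? = none ∧ ∀ e, d = fwd e → p e

/-- The letters written after the input is read, with a restriction on the guesses. -/
def BwdOk (p : GuessLetter α γ → Prop) (d : QueryLetter α (GuessLetter α γ)) : Prop :=
  ∃ e, d = bwd e ∧ p e

/-- The first part of the first oracle: the two-track string belongs to `B`. -/
def oraclePair (B : Language (Option α × Option γ)) :
    Language (QueryLetter α (GuessLetter α γ)) :=
  {s | (∀ d ∈ s, FwdOk (fun e => ∃ c, e = .pair c) d) ∧
    s.filterMap (fun d => d.fwd?.bind pair?) ∈ B}

/-- The second part of the first oracle: the two histories are the reversals of each other. -/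
def oracleRev (α γ : Type) : Language (QueryLetter α (GuessLetter α γ)) :=
  mirror (FwdOk fun e => ∃ c, e = .rev c)
    (fun _ d (_ : Unit) => FwdOk (fun e => ∃ c, e = .hist c) d) ()
    (fun d => d.fwd?.bind rev?) (fun d => d.fwd?.bind hist?)

/-- The third part of the first oracle: the history is a computation history of `M`. -/
def oracleHist (M : NPDA α (Option γ)) : Language (QueryLetter α (GuessLetter α γ)) :=
  {s | (∀ d ∈ s, BwdOk (fun e => ∃ c, e = .hist c) d) ∧
    s.filterMap (fun d => d.bwd?.bind hist?) ∈ (histories M).reverse}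

/-- The last part of the first oracle: the upper track is the input in the history. -/
def oracleInput (α γ : Type) : Language (QueryLetter α (GuessLetter α γ)) :=
  mirror (BwdOk fun e => ∃ c, e = .rev c)
    (fun q d q' => ∃ c, d = bwd (.pair c) ∧ TrackStep q c q') (true, true)
    (fun d => (d.bwd?.bind rev?).bind inputSymbol) (fun d => (d.bwd?.bind pair?).bind Prod.fst)

/-- The first part of the second oracle: the tape is the tape in the history. -/
def oracleTape (α γ : Type) : Language (QueryLetter α (GuessLetter α γ)) :=
  mirror (FwdOk fun _ => True) (fun _ d (_ : Unit) => BwdOk (fun e => ∃ c, e = .hist c) d) ()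
    QueryLetter.tape? (fun d => (d.bwd?.bind hist?).bind Prod.fst)

/-- The last part of the second oracle: the lower track is the output in the history. -/
def oracleOutput (α γ : Type) : Language (QueryLetter α (GuessLetter α γ)) :=
  mirror (BwdOk fun e => ∃ c, e = .rev c)
    (fun _ d (_ : Unit) => BwdOk (fun e => ∃ c, e = .pair c) d) ()
    (fun d => (d.bwd?.bind rev?).bind Prod.snd) (fun d => (d.bwd?.bind pair?).bind Prod.snd)

/-- The first oracle. -/
def oracle₁ (B : Language (Option α × Option γ)) (M : NPDA α (Option γ)) :
    Language (QueryLetter α (GuessLetter α γ)) :=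
  oraclePair B * oracleRev α γ * (oracleHist M * oracleInput α γ)

/-- The second oracle. -/
def oracle₂ (α γ : Type) : Language (QueryLetter α (GuessLetter α γ)) :=
  oracleTape α γ * oracleOutput α γ

theorem oracle₁_isContextFree [Finite α] [Finite γ] {B : Language (Option α × Option γ)}
    (hB : B.IsContextFree) (M : NPDA α (Option γ)) : (oracle₁ B M).IsContextFree :=
  IsContextFree.mul
    (IsContextFree.mul (IsContextFree.filterMap_preimage hB _ _) (mirror_isContextFree _ _ _ _ _))
    (IsContextFree.mul (IsContextFree.filterMap_preimage (histories_isContextFree M).reverse _ _)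
      (mirror_isContextFree _ _ _ _ _))

theorem oracle₂_isContextFree [Finite α] [Finite γ] : (oracle₂ α γ).IsContextFree :=
  IsContextFree.mul (mirror_isContextFree _ _ _ _ _) (mirror_isContextFree _ _ _ _ _)

/-- The letters of a first half all of whose guesses are allowed. -/
theorem forall_fwdOk {p : GuessLetter α γ → Prop} {s : List (QueryLetter α (GuessLetter α γ))}
    (h₁ : s.filterMap bwd? = []) (h₂ : ∀ e ∈ s.filterMap fwd?, p e) : ∀ d ∈ s, FwdOk p d := by
  refine fun d hd => ⟨List.filterMap_eq_nil_iff.1 h₁ d hd, ?_⟩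
  rintro e rfl
  exact h₂ e (List.mem_filterMap.2 ⟨_, hd, rfl⟩)

theorem FwdOk.cases {p : GuessLetter α γ → Prop} {d : QueryLetter α (GuessLetter α γ)}
    (h : FwdOk p d) : (∃ a, d = .tape a) ∨ ∃ e, d = fwd e ∧ p e := by
  cases d with
  | tape a => exact .inl ⟨a, rfl⟩
  | fwd e => exact .inr ⟨e, rfl, h.2 e rfl⟩
  | bwd e => cases h.1

theorem filterMap_bind {A B C : Type} (s : List A) (f : A → Option B) (g : B → Option C) :
    s.filterMap (fun a => (f a).bind g) = (s.filterMap f).filterMap g :=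
  List.filterMap_filterMap.symm

theorem exists_map_of_fwdOk {T : Type} {c : T → GuessLetter α γ}
    {s : List (QueryLetter α (GuessLetter α γ))} (h : ∀ d ∈ s, FwdOk (fun e => ∃ a, e = c a) d) :
    s.filterMap bwd? = [] ∧ ∃ l : List T, s.filterMap fwd? = l.map c := by
  induction s with
  | nil => exact ⟨rfl, [], rfl⟩
  | cons d s ih =>
    rw [List.forall_mem_cons] at h
    obtain ⟨h₁, l, h₂⟩ := ih h.2
    obtain ⟨a, rfl⟩ | ⟨_, rfl, a, rfl⟩ := h.1.cases
    · exact ⟨h₁, l, h₂⟩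
    · exact ⟨h₁, a :: l, congrArg (c a :: ·) h₂⟩

theorem exists_map_of_bwdOk {T : Type} {c : T → GuessLetter α γ}
    {s : List (QueryLetter α (GuessLetter α γ))} (h : ∀ d ∈ s, BwdOk (fun e => ∃ a, e = c a) d) :
    ∃ l : List T, s = l.map fun a => bwd (c a) := by
  induction s with
  | nil => exact ⟨[], rfl⟩
  | cons d s ih =>
    rw [List.forall_mem_cons] at h
    obtain ⟨l, rfl⟩ := ih h.2
    obtain ⟨_, rfl, a, rfl⟩ := h.1
    exact ⟨a :: l, rfl⟩

theorem exists_of_mem_map {T A : Type} {c : T → A} {l : List T} : ∀ e ∈ l.map c, ∃ a, e = c a := by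
  intro e he
  obtain ⟨a, -, rfl⟩ := List.mem_map.1 he
  exact ⟨a, rfl⟩

theorem forall_bwdOk {T : Type} {c : T → GuessLetter α γ} {l : List T} :
    ∀ d ∈ l.map fun a => bwd (c a),
      BwdOk (α := α) (fun e => ∃ a, e = c a) d := by
  intro d hd
  obtain ⟨a, rfl⟩ := exists_of_mem_map d hd
  exact ⟨_, rfl, a, rfl⟩

theorem path_bwd_pair_iff {q : Bool × Bool} {s : List (QueryLetter α (GuessLetter α γ))} :
    Path (fun q d q' => ∃ c, d = bwd (.pair c) ∧ TrackStep q c q') q s ↔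
      ∃ l, s = l.map (fun c => bwd (.pair c)) ∧ Path TrackStep q l := by
  induction s generalizing q with
  | nil =>
    refine ⟨fun _ => ⟨[], rfl, trivial⟩, fun _ => trivial⟩
  | cons d s ih =>
    constructor
    · rintro ⟨q', ⟨c, rfl, hc⟩, h⟩
      obtain ⟨l, rfl, hl⟩ := ih.1 h
      exact ⟨c :: l, rfl, q', hc, hl⟩
    · rintro ⟨_ | ⟨c, l⟩, h, hl⟩
      · cases h
      · cases h
        obtain ⟨q', hc, hl⟩ := hl
        exact ⟨q', ⟨c, rfl, hc⟩, ih.2 ⟨l, rfl, hl⟩⟩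

/-- What membership in the first oracle says about the letters of the guess. -/
theorem oracle₁_sound {B : Language (Option α × Option γ)} {M : NPDA α (Option γ)}
    {s : List (QueryLetter α (GuessLetter α γ))} (hs : s ∈ oracle₁ B M) :
    (s.filterMap fwd?).filterMap pair? ∈ B ∧
    (s.filterMap fwd?).filterMap rev? = ((s.filterMap fwd?).filterMap hist?).reverse ∧
    ((s.filterMap bwd?).filterMap hist?).reverse ∈ histories M ∧
    Path TrackStep (true, true) ((s.filterMap bwd?).filterMap pair?).reverse ∧
    ((s.filterMap bwd?).filterMap rev?).filterMap inputSymbol =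
      ((s.filterMap bwd?).filterMap pair?).reverse.filterMap Prod.fst := by
  obtain ⟨_, h, _, h', rfl⟩ := Language.mem_mul.1 hs
  obtain ⟨s₁, ⟨ok₁, h₁⟩, _, ⟨p₂, r₂, rfl, okp₂, okr₂, h₂⟩, rfl⟩ := Language.mem_mul.1 h
  obtain ⟨s₃, ⟨ok₃, h₃⟩, _, ⟨p₄, r₄, rfl, okp₄, okr₄, h₄⟩, rfl⟩ := Language.mem_mul.1 h'
  obtain ⟨b₁, l₁, e₁⟩ := exists_map_of_fwdOk ok₁
  obtain ⟨b₂, l₂, e₂⟩ := exists_map_of_fwdOk okp₂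
  obtain ⟨b₂', l₂', e₂'⟩ := exists_map_of_fwdOk (path_unit_iff.1 okr₂)
  obtain ⟨l₃, rfl⟩ := exists_map_of_bwdOk ok₃
  obtain ⟨l₄, rfl⟩ := exists_map_of_bwdOk okp₄
  obtain ⟨l₄', rfl, hp⟩ := path_bwd_pair_iff.1 okr₄
  rw [Language.mem_reverse] at h₃
  rw [filterMap_bind, e₁] at h₁
  rw [filterMap_bind, filterMap_bind, e₂, e₂'] at h₂
  simp [List.filterMap_map, Function.comp_def, pair?, rev?, hist?, bwd?] at h₁ h₂ h₃ h₄
  subst h₂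
  simp [List.filterMap_map, List.filterMap_reverse, Function.comp_def, pair?, rev?, hist?, fwd?,
    bwd?, e₁, e₂, e₂', b₁, b₂, b₂', h₁, h₃, h₄, hp]

/-- What membership in the second oracle says about the letters of the guess. -/
theorem oracle₂_sound {s : List (QueryLetter α (GuessLetter α γ))} (hs : s ∈ oracle₂ α γ) :
    s.filterMap tape? = ((s.filterMap bwd?).filterMap hist?).reverse.filterMap Prod.fst ∧
    ((s.filterMap bwd?).filterMap rev?).filterMap Prod.snd =
      ((s.filterMap bwd?).filterMap pair?).reverse.filterMap Prod.snd := by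
  obtain ⟨_, ⟨p₁, r₁, rfl, okp₁, okr₁, h₁⟩, _, ⟨p₂, r₂, rfl, okp₂, okr₂, h₂⟩, rfl⟩ :=
    Language.mem_mul.1 hs
  have b₁ : p₁.filterMap bwd? = [] := List.filterMap_eq_nil_iff.2 fun d hd => (okp₁ d hd).1
  obtain ⟨l₁, rfl⟩ := exists_map_of_bwdOk (path_unit_iff.1 okr₁)
  obtain ⟨l₂, rfl⟩ := exists_map_of_bwdOk okp₂
  obtain ⟨l₂', rfl⟩ := exists_map_of_bwdOk (path_unit_iff.1 okr₂)
  simp [List.filterMap_map, Function.comp_def, pair?, rev?, hist?, bwd?] at h₁ h₂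
  simp [List.filterMap_map, List.filterMap_reverse, Function.comp_def, pair?, rev?, hist?, tape?,
    bwd?, b₁, h₁, h₂]

theorem inputSymbol_eq (d : Option (TapeSymbol α) × Option γ) :
    inputSymbol d = d.1.bind fun s => match s with
      | .sym a => some a
      | _ => none := by
  rcases d with ⟨_ | _ | _ | _, _⟩ <;> rfl

theorem filterMap_inputSymbol {w : List (Option (TapeSymbol α) × Option γ)} {x : List α}
    (h : w.filterMap Prod.fst = tape x) : w.filterMap inputSymbol = x := by
  rw [funext inputSymbol_eq, filterMap_bind, h]
  simp [tape, List.filterMap_map]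

/-- The letters guessed for the two-track string `u` and the computation history `w`. -/
def guess (u : List (Option α × Option γ)) (w : List (Option (TapeSymbol α) × Option γ)) :
    List (GuessLetter α γ) :=
  u.map pair ++ (w.reverse.map rev ++ w.map hist)

variable {B : Language (Option α × Option γ)} {M : NPDA α (Option γ)}
  {s : List (QueryLetter α (GuessLetter α γ))} {u : List (Option α × Option γ)}
  {w : List (Option (TapeSymbol α) × Option γ)}

/-- Reversal puts the reversed history right after the first half, facing the copied tape, and the
history in its original order right before the reversed two-track string. -/
theorem query_guess (hs : s.filterMap fwd? = guess u w) :
    query s = s ++ ((w.map fun d => bwd (hist d)).reverse ++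
      ((w.map fun d => bwd (rev d)) ++ (u.map fun d => bwd (pair d)).reverse)) := by
  rw [query, hs]
  simp [guess, Function.comp_def]

theorem oracle₁_complete (hs : s.filterMap fwd? = guess u w) (hb : s.filterMap bwd? = [])
    (hu : u ∈ B) (hw : w ∈ histories M) (hp : Path TrackStep (true, true) u)
    (hx : w.filterMap inputSymbol = u.filterMap Prod.fst) : query s ∈ oracle₁ B M := by
  rw [query_guess hs]
  -- The first half is cut where the guessed blocks meet; `FwdOk` tolerates tape symbols anywhere,
  -- so it does not matter how they are interleaved.
  obtain ⟨s₁, _, rfl, e₁, e'⟩ := List.filterMap_eq_append_iff.1 hs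
  obtain ⟨s₂, s₃, rfl, e₂, e₃⟩ := List.filterMap_eq_append_iff.1 e'
  simp only [List.filterMap_append, List.append_eq_nil_iff] at hb
  obtain ⟨b₁, b₂, b₃⟩ := hb
  refine Language.append_mem_mul (Language.append_mem_mul ⟨?_, ?_⟩ ⟨s₂, s₃.reverse, ?_, ?_, ?_, ?_⟩)
    (Language.append_mem_mul ⟨?_, ?_⟩ ⟨w.map fun d => bwd (rev d), u.map fun d => bwd (pair d),
      rfl, ?_, ?_, ?_⟩)
  · exact forall_fwdOk b₁ (e₁ ▸ exists_of_mem_map)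
  · rw [filterMap_bind, e₁]
    simpa [List.filterMap_map, Function.comp_def, pair?] using hu
  · rw [List.reverse_reverse]
  · exact forall_fwdOk b₂ (e₂ ▸ exists_of_mem_map)
  · rw [path_unit_iff]
    exact fun d hd => forall_fwdOk b₃ (e₃ ▸ exists_of_mem_map) d (List.mem_reverse.1 hd)
  · rw [filterMap_bind, filterMap_bind, List.filterMap_reverse, e₂, e₃]
    simp [List.filterMap_map, Function.comp_def, rev?, hist?, List.filterMap_reverse]
  · exact fun d hd => forall_bwdOk d (List.mem_reverse.1 hd)
  · rw [Language.mem_reverse]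
    simpa [List.filterMap_map, Function.comp_def, hist?, bwd?, List.filterMap_reverse] using hw
  · exact forall_bwdOk
  · exact path_bwd_pair_iff.2 ⟨u, rfl, hp⟩
  · simpa [List.filterMap_map, Function.comp_def, pair?, rev?, bwd?] using hx

theorem oracle₂_complete (hs : s.filterMap fwd? = guess u w)
    (hb : s.filterMap bwd? = []) (hx : s.filterMap tape? = w.filterMap Prod.fst)
    (hy : w.filterMap Prod.snd = u.filterMap Prod.snd) : query s ∈ oracle₂ α γ := by
  rw [query_guess hs, ← List.append_assoc]
  refine Language.append_mem_mul ⟨s, w.map fun d => bwd (hist d), rfl, ?_, ?_, ?_⟩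
    ⟨w.map fun d => bwd (rev d), u.map fun d => bwd (pair d), rfl, ?_, ?_, ?_⟩
  · exact forall_fwdOk hb (by simp)
  · exact path_unit_iff.2 forall_bwdOk
  · simpa [List.filterMap_map, Function.comp_def, hist?, bwd?] using hx
  · exact forall_bwdOk
  · exact path_unit_iff.2 forall_bwdOk
  · simpa [List.filterMap_map, Function.comp_def, pair?, rev?, bwd?] using hy

end Oracles

/-! ### The inclusions -/

/-- The oracle npda guesses a two-track string `u`, a reversed computation history and the history
`w` itself while it reads the input, and repeats the guesses in reverse order.  Two context-free
oracles suffice to verify that `u` consists of the input and the output of `w`: all comparisons are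
between neighbouring parts of the query, one of which is reversed. -/
theorem advice_subset_CFLm (α : Type) [Finite α] : advice CFL CFLMV α ⊆ CFLm (CFLConj 2) α := by
  rintro L ⟨γ, hγ, B, hB, h, ⟨M, hM, hh⟩, rfl⟩
  refine ⟨QueryLetter α (GuessLetter α γ), inferInstance, oracle₁ B M ⊓ oracle₂ α γ,
    ⟨![oracle₁ B M, oracle₂ α γ], ?_, ?_⟩, ?_⟩
  · rw [Fin.forall_fin_two]
    exact ⟨oracle₁_isContextFree hB M, oracle₂_isContextFree⟩
  · ext s
    change _ ↔ ∀ i, _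
    rw [Language.mem_inf, Fin.forall_fin_two]
    rfl
  · obtain ⟨a, b, hab⟩ := exists_history hM
    -- The guess has length at most `x.length + 3 * w.length`: two copies of `w`, and a two-track
    -- string no longer than `x` and the output of `w` together. Here `w.length ≤ a * x.length + b`.
    refine mem_CFLmOracle_of_query (3 * a + 3 * b + 1) ?_ ?_
    · rintro x s hx hb ⟨h₁, h₂⟩
      obtain ⟨hB', hr, hw, hp, hi⟩ := oracle₁_sound h₁
      obtain ⟨ht, ho⟩ := oracle₂_sound h₂
      have e₁ : (query s).filterMap fwd? = s.filterMap fwd? := by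
        simp [query, List.filterMap_map, Function.comp_def, fwd?]
      have e₂ : (query s).filterMap bwd? = (s.filterMap fwd?).reverse := by
        simp [query, List.filterMap_map, Function.comp_def, bwd?, hb]
      have e₃ : (query s).filterMap tape? = tape x := by
        simp [query, List.filterMap_map, Function.comp_def, tape?, hx]
      simp only [e₁, e₂, e₃, List.filterMap_reverse, List.reverse_reverse] at hB' hr hw hp hi ht ho
      -- By `hr` the reversed copy is the reversal of the guessed history, so the tape and both
      -- tracks are all compared with one and the same history.
      simp only [hr, List.filterMap_reverse, List.reverse_reverse] at hi ho
      rw [filterMap_inputSymbol ht.symm] at hi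
      have e := (eq_track_of_path hp).1
      rw [← hi, ← ho] at e
      refine ⟨_, hh x ▸ mem_outcomes_of_history hw ht.symm, ?_⟩
      rw [← e]
      exact hB'
    · rintro x ⟨y, hy, hxy⟩
      rw [hh] at hy
      obtain ⟨w, hw, hx, rfl, hl⟩ := hab x y hy
      refine ⟨guess (track x (w.filterMap Prod.snd)) w, ?_, fun s hs hb hP => ⟨?_, ?_⟩⟩
      · have h₁ := length_track_le x (w.filterMap Prod.snd)
        have h₂ := List.length_filterMap_le Prod.snd w
        simp only [guess, List.length_append, List.length_map, List.length_reverse]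
        nlinarith
      · exact oracle₁_complete hP hb hxy hw (path_track _ _ _ (by simp) (by simp))
          (by rw [filterMap_inputSymbol hx, filterMap_fst_track])
      · exact oracle₂_complete hP hb (by rw [hs, hx]) (by rw [filterMap_snd_track])

/-- A deterministic automaton is a linear grammar that never writes on the right. -/
theorem isContextFree_of_isRegular {δ : Type} [Finite δ] {L : Language δ} (hL : L.IsRegular) :
    L.IsContextFree := by
  obtain ⟨σ, _, D, rfl⟩ := hL
  let R : σ → Option δ → Option δ → σ → Prop := fun q l r q' =>
    r = none ∧ ∃ a, l = some a ∧ q' = D.step q a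
  have key : ∀ q s, Linear R (· ∈ D.accept) q s ↔ D.evalFrom q s ∈ D.accept := by
    intro q s
    constructor
    · intro h
      induction h with
      | done h => exact h
      | step h _ ih =>
        obtain ⟨rfl, a, rfl, rfl⟩ := h
        simpa using ih
    · intro h
      induction s generalizing q with
      | nil => exact .done h
      | cons a s ih =>
        have := Linear.step (R := R) (l := some a) (r := none) ⟨rfl, a, rfl, rfl⟩ (ih _ h)
        simpa using this
  suffices h : D.accepts = ({s | Linear R (· ∈ D.accept) D.start s} : Set _) from
    h ▸ Linear.isContextFree R _ D.start
  ext s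
  exact (key _ _).symm

theorem CFLConj_two_subset (α : Type) : CFLConj 2 α ⊆ CFLConj 3 α := by
  rintro L ⟨A, hA, rfl⟩
  refine ⟨![A 0, A 1, A 1], ?_, ?_⟩
  · simp [Fin.forall_fin_succ, hA]
  · ext w
    change (∀ i, _) ↔ ∀ i, _
    simp [Fin.forall_fin_succ]

end CFLFun

theorem mainTheorem10 (α : Type) [Finite α] :
    CFLFun.advice CFLFun.REG CFLFun.CFLSVt α ⊆
        CFLFun.CFLm (CFLFun.CFLConj 2) α ∩ CFLFun.co (CFLFun.CFLm (CFLFun.CFLConj 2)) α ∧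
      CFLFun.advice CFLFun.CFL CFLFun.CFLSVt α ⊆ CFLFun.CFLm (CFLFun.CFLConj 3) α := by
  have main := CFLFun.advice_subset_CFLm α
  refine ⟨?_, ?_⟩
  · rintro L ⟨γ, hγ, B, hB, h, ⟨⟨hM, hs⟩, ht⟩, rfl⟩
    refine ⟨main ⟨γ, hγ, B, CFLFun.isContextFree_of_isRegular hB, h, hM, rfl⟩,
      main ⟨γ, hγ, Bᶜ, CFLFun.isContextFree_of_isRegular (Language.IsRegular.compl hB), h, hM, ?_⟩⟩
    -- Totality supplies a value of `h x` outside `B` from the failure of the existential;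
    -- single-valuedness gives the converse.
    ext x
    change (¬ ∃ y ∈ h x, _) ↔ ∃ y ∈ h x, ¬ _
    constructor
    · intro hn
      obtain ⟨y, hy⟩ := ht x
      exact ⟨y, hy, fun hB => hn ⟨y, hy, hB⟩⟩
    · rintro ⟨y, hy, hn⟩ ⟨y', hy', hB⟩
      exact hn (hs x hy hy' ▸ hB)
  · rintro L ⟨γ, hγ, B, hB, h, ⟨⟨hM, -⟩, -⟩, rfl⟩
    obtain ⟨δ, hδ, A, hA, h⟩ := main ⟨γ, hγ, B, hB, h, hM, rfl⟩
    exact ⟨δ, hδ, A, CFLFun.CFLConj_two_subset δ hA, h⟩
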